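/- \textbf{Setting.} Let $M=\langle\mathcal S,\mathcal A,r,c,H,P,\bar C\rangle$ be a finite episodic constrained MDP with $S=|\mathcal S|$, $A=|\mathcal A|$, costs $r,c:\mathcal S\times\mathcal A\to[0,1]$, horizon $H$, transition probabilities $P(s'|s,a)$ and fixed initial state $s^1$. A policy is $\pi=(\pi^h)_{h=1}^H$ with $\pi^h(s,\cdot)$ a probability vector on $\mathcal A$. For a cost $l$ and a model (transition function) $P'$ put $V_l^{\pi}(P')=\mathbb E[\sum_{h=1}^H l(s^h,a^h)\mid s^1]$, where $a^h\sim\pi^h(s^h,\cdot)$, $s^{h+1}\sim P'(\cdot|s^h,a^h)$. The policy $\pi$ is safe if $V_c^\pi(P)\le\bar C$. A baseline policy $\pi_b$ with $V_c^{\pi_b}(P)=\bar C_b<\bar C$ is given. \textbf{Algorithm (OPSRL).} Fix $\delta\in(0,1)$, a number $K$ of episodes and $K_o\in\mathbb N$, and let $L=\log\frac{2SAHK}{\delta}$. Before episode $k$ let $n_k(s,a)$ and $n_k(s,a,s')$ be the numbers of time steps $h\in[H]$ of episodes $1,\dots,k-1$ at which $(s,a)$, respectively $(s,a)$ followed by $s'$,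 was observed, and let $$\widehat P_k(s'|s,a)=\frac{n_k(s,a,s')}{n_k(s,a)\vee1},\qquad \beta_k(s,a,s')=\sqrt{\frac{4\widehat P_k(s'|s,a)(1-\widehat P_k(s'|s,a))L}{n_k(s,a)\vee 1}}+\frac{14L}{3(n_k(s,a)\vee1)},$$ $$\bar\beta_k=\sum_{s'}\beta_k(\cdot,\cdot,s'),\quad \mathcal P_k=\{P' \text{ a model}: |P'(s'|s,a)-\widehat P_k(s'|s,a)|\le\beta_k(s,a,s')\ \forall s,a,s'\},$$ $$c_k=c+H\bar\beta_k,\qquad r_k=r-\tfrac{H^2}{\bar C-\bar C_b}\bar\beta_k .$$ In episode $k\le K_o$ the algorithm plays $\pi_k=\pi_b$. In episode $k>K_o$ it plays the policy part $\pi_k$ of a minimizer $(\pi_k,P_k)$ of $V_{r_k}^{\pi'}(P')$ over all policies $\pi'$ and models $P'\in\mathcal P_k$ with $V_{c_k}^{\pi'}(P')\le\bar C$ (the OP problem; ties are broken by an arbitrary function of the past observations). If the OP problem is infeasible, $\pi_k$ is an arbitrary policy, chosen as a function of the past. Every episode starts in $s^1$ and is run in the true model $P$. \textbf{Proposition.}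 There are absolute constants $\kappa>0$ and $p\in\mathbb N$ such that the following holds for all such data. (i) For every $K_o$, with probability greater than $1-3\delta$, the policy $\pi_k$ is safe, $V_c^{\pi_k}(P)\le\bar C$, for every $k\in[K]$ such that $k\le K_o$ or the OP problem of episode $k$ is feasible. (ii) If $K_o\ge\kappa\,\frac{S^2AH^3}{(\bar C-\bar C_b)^2}\,L^p$, then, with probability greater than $1-3\delta$, the policy $\pi_k$ is safe, $V_c^{\pi_k}(P)\le\bar C$, for all $k\in[K]$. -/

import Mathlib

open scoped BigOperators ENNReal

noncomputable section

namespace OPSRL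

/-- Models: transition probability functions `P(s' | s, a)`, written `P s a s'`. -/
abbrev Model (S A : Type*) [Fintype S] : Type _ :=
  {P : S → A → S → ℝ // ∀ s a, P s a ∈ stdSimplex ℝ S}

/-- Non-stationary randomized policies for `H` time steps; `π h s a` is the probability of
taking action `a` in state `s` at time step `h`. -/
abbrev Policy (S A : Type*) [Fintype A] (H : ℕ) : Type _ :=
  {π : Fin H → S → A → ℝ // ∀ h s, π h s ∈ stdSimplex ℝ A}

/-- Trajectories of one episode: the states `s¹, …, s^{H+1}` and the actions `a¹, …, a^H`. -/
abbrev Traj (S A : Type*) (H : ℕ) : Type _ := (Fin (H + 1) → S) × (Fin H → A)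

variable {S A : Type*} [Fintype S] [DecidableEq S] [Fintype A] [DecidableEq A]

/-- Probability of a trajectory that starts in `s₁` and then draws `a^h ∼ π^h(s^h, ·)` and
`s^{h+1} ∼ P(· | s^h, a^h)`. -/
def trajMass {H : ℕ} (P : Model S A) (π : Policy S A H) (s₁ : S) (τ : Traj S A H) : ℝ≥0∞ :=
  (if τ.1 0 = s₁ then 1 else 0) *
    ∏ h : Fin H, ENNReal.ofReal (π.1 h (τ.1 h.castSucc) (τ.2 h)) *
      ENNReal.ofReal (P.1 (τ.1 h.castSucc) (τ.2 h) (τ.1 h.succ))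

theorem sum_ofReal_of_mem_stdSimplex {X : Type*} [Fintype X] {f : X → ℝ}
    (hf : f ∈ stdSimplex ℝ X) : ∑ x, ENNReal.ofReal (f x) = 1 := by
  rw [← ENNReal.ofReal_sum_of_nonneg (fun x _ => hf.1 x), hf.2, ENNReal.ofReal_one]

theorem sum_trajMass {H : ℕ} (P : Model S A) (π : Policy S A H) (s₁ : S) :
    ∑ τ : Traj S A H, trajMass P π s₁ τ = 1 := by
  induction H generalizing s₁ with
  | zero =>
    have e : ∀ τ : Traj S A 0, trajMass P π s₁ τ = if τ.1 0 = s₁ then 1 else 0 := by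
      intro τ; simp [trajMass]
    simp only [e]
    rw [Finset.sum_eq_single ((fun _ => s₁, Fin.elim0) : Traj S A 0)]
    · simp
    · intro τ _ hτ
      rw [if_neg]
      intro h0
      exact hτ (Prod.ext (funext fun i => by rw [Fin.fin_one_eq_zero i]; exact h0)
        (funext fun i => i.elim0))
    · simp
  | succ H ih =>
    let π' : Policy S A H := ⟨fun h => π.1 h.succ, fun h s => π.2 h.succ s⟩
    rw [Fintype.sum_prod_type, ← (Fin.consEquiv (fun _ => S)).sum_comp, Fintype.sum_prod_type]
    simp_rw [← (Fin.consEquiv (fun _ : Fin (H + 1) => A)).sum_comp, Fintype.sum_prod_type]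
    have e : ∀ (x : S) (y : Fin (H + 1) → S) (a : A) (b : Fin H → A),
        trajMass P π s₁ ((Fin.consEquiv (fun _ => S)) (x, y),
          (Fin.consEquiv (fun _ : Fin (H + 1) => A)) (a, b)) =
        (if x = s₁ then 1 else 0) * (ENNReal.ofReal (π.1 0 x a) * ∑ s' : S,
          ENNReal.ofReal (P.1 x a s') * trajMass P π' s' (y, b)) := by
      intro x y a b
      have h2 : ∑ s' : S, ENNReal.ofReal (P.1 x a s') * trajMass P π' s' (y, b) =
          ENNReal.ofReal (P.1 x a (y 0)) * trajMass P π' (y 0) (y, b) := by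
        rw [Finset.sum_eq_single (y 0)]
        · intro s' _ hs
          simp [trajMass, Ne.symm hs]
        · simp
      rw [h2]
      simp only [trajMass, Fin.consEquiv, Equiv.coe_fn_mk, Fin.prod_univ_succ, Fin.cons_zero,
        Fin.castSucc_zero, Fin.cons_succ, ← Fin.succ_castSucc, π', if_true, one_mul]
      ring
    simp_rw [e, ← Finset.mul_sum]
    rw [Finset.sum_eq_single s₁ (by intro x _ hx; simp [hx]) (by simp)]
    simp only [if_true, one_mul]
    rw [Finset.sum_comm]
    simp_rw [← Finset.mul_sum]
    have e2 : ∀ a : A, ∑ y : Fin (H + 1) → S, ∑ b : Fin H → A, ∑ s' : S,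
        ENNReal.ofReal (P.1 s₁ a s') * trajMass P π' s' (y, b) = 1 := by
      intro a
      calc _ = ∑ τ : Traj S A H, ∑ s' : S,
            ENNReal.ofReal (P.1 s₁ a s') * trajMass P π' s' τ :=
            (Fintype.sum_prod_type
              (f := fun τ : Traj S A H => ∑ s' : S,
                ENNReal.ofReal (P.1 s₁ a s') * trajMass P π' s' τ)).symm
        _ = 1 := by
          rw [Finset.sum_comm]
          simp_rw [← Finset.mul_sum, ih, mul_one]
          exact sum_ofReal_of_mem_stdSimplex (P.2 s₁ a)
    simp_rw [e2, mul_one]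
    exact sum_ofReal_of_mem_stdSimplex (π.2 0 s₁)

/-- The law of one episode. -/
def episodeLaw {H : ℕ} (P : Model S A) (π : Policy S A H) (s₁ : S) : PMF (Traj S A H) :=
  PMF.ofFintype (trajMass P π s₁) (sum_trajMass P π s₁)

/-- The value `V_l^π(s₁; P) = E[∑_{h=1}^H l(s^h, a^h) | s¹ = s₁]`. -/
def value {H : ℕ} (l : S → A → ℝ) (π : Policy S A H) (P : Model S A) (s₁ : S) : ℝ :=
  ∑ τ : Traj S A H, (episodeLaw P π s₁ τ).toReal * ∑ h : Fin H, l (τ.1 h.castSucc) (τ.2 h)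

/-- A learning rule: after `k` completed episodes, with the observed trajectories as input, it
returns the policy of the next episode (which is episode number `k + 1`). -/
abbrev Rule (S A : Type*) [Fintype A] (H : ℕ) : Type _ :=
  (k : ℕ) → (Fin k → Traj S A H) → Policy S A H

/-- What has been observed before the `k`-th entry of a run (entries are counted from `0`). -/
def past {X : Type*} {K : ℕ} (ω : Fin K → X) (k : Fin K) : Fin k → X :=
  fun j => ω (j.castLE k.isLt.le)

/-- The probability of a run of `K` episodes: each episode is drawn from the law of the policy
that the rule returns on the past. -/
def runMass {H K : ℕ} (P : Model S A) (s₁ : S) (ρ : Rule S A H) (ω : Fin K → Traj S A H) :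
    ℝ≥0∞ :=
  ∏ k : Fin K, episodeLaw P (ρ k (past ω k)) s₁ (ω k)

theorem sum_runMass {H : ℕ} (K : ℕ) (P : Model S A) (s₁ : S) (ρ : Rule S A H) :
    ∑ ω : Fin K → Traj S A H, runMass P s₁ ρ ω = 1 := by
  induction K with
  | zero => simp [runMass]
  | succ K ih =>
    rw [← (Fin.snocEquiv (fun _ => Traj S A H)).sum_comp, Fintype.sum_prod_type,
      Finset.sum_comm]
    have e : ∀ (y : Fin K → Traj S A H) (x : Traj S A H),
        runMass P s₁ ρ ((Fin.snocEquiv (fun _ => Traj S A H)) (x, y)) =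
        runMass P s₁ ρ y * episodeLaw P (ρ K y) s₁ x := by
      intro y x
      have h1 : ∀ k : Fin K, past ((Fin.snocEquiv (fun _ => Traj S A H)) (x, y)) k.castSucc =
          past y k := by
        intro k
        funext j
        exact Fin.snoc_castSucc (α := fun _ => Traj S A H) x y (j.castLE k.isLt.le)
      have h2 : past ((Fin.snocEquiv (fun _ => Traj S A H)) (x, y)) (Fin.last K) = y := by
        funext j
        exact Fin.snoc_castSucc (α := fun _ => Traj S A H) x y j
      have h3 : ∀ k : Fin K, (Fin.snocEquiv (fun _ => Traj S A H)) (x, y) k.castSucc = y k :=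
        fun k => Fin.snoc_castSucc (α := fun _ => Traj S A H) x y k
      have h4 : (Fin.snocEquiv (fun _ => Traj S A H)) (x, y) (Fin.last K) = x :=
        Fin.snoc_last (α := fun _ => Traj S A H) x y
      unfold runMass
      rw [Fin.prod_univ_castSucc, h4]
      congr 1
      · refine Finset.prod_congr rfl fun k _ => ?_
        rw [h3]
        exact congrArg (fun z => episodeLaw P (ρ k z) s₁ (y k)) (h1 k)
      · exact congrArg (fun z => episodeLaw P (ρ K z) s₁ x) h2
    simp_rw [e, ← Finset.mul_sum]
    have h : ∀ y : Fin K → Traj S A H, ∑ x, episodeLaw P (ρ K y) s₁ x = 1 := by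
      intro y
      exact sum_trajMass P (ρ K y) s₁
    simp_rw [h, mul_one, ih]

/-- The law of the `K` episodes produced by the rule `ρ` in the true model `P`. -/
def runLaw {H : ℕ} (K : ℕ) (P : Model S A) (s₁ : S) (ρ : Rule S A H) :
    PMF (Fin K → Traj S A H) :=
  PMF.ofFintype (runMass P s₁ ρ) (sum_runMass K P s₁ ρ)

/-- The probability of an event about the `K` episodes. -/
def runProb {H K : ℕ} (P : Model S A) (s₁ : S) (ρ : Rule S A H)
    (E : Set (Fin K → Traj S A H)) : ℝ :=
  ((runLaw K P s₁ ρ).toOuterMeasure E).toReal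

/-! ### Empirical model and confidence set -/

/-- The number of visits of `(s, a)` in the observed episodes. -/
def count {H k : ℕ} (η : Fin k → Traj S A H) (s : S) (a : A) : ℕ :=
  ∑ j : Fin k, ∑ h : Fin H,
    if (η j).1 h.castSucc = s ∧ (η j).2 h = a then 1 else 0

/-- The number of visits of `(s, a)` that were followed by the state `s'`. -/
def countNext {H k : ℕ} (η : Fin k → Traj S A H) (s : S) (a : A) (s' : S) : ℕ :=
  ∑ j : Fin k, ∑ h : Fin H,
    if (η j).1 h.castSucc = s ∧ (η j).2 h = a ∧ (η j).1 h.succ = s' then 1 else 0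

/-- The empirical model `P̂(s' | s, a)`. -/
def empModel {H k : ℕ} (η : Fin k → Traj S A H) (s : S) (a : A) (s' : S) : ℝ :=
  (countNext η s a s' : ℝ) / (max (count η s a) 1 : ℕ)

/-- `L = log (2 S A H K / δ)`. -/
def logTerm (S A : Type*) [Fintype S] [Fintype A] (H K : ℕ) (δ : ℝ) : ℝ :=
  Real.log (2 * Fintype.card S * Fintype.card A * H * K / δ)

/-- The confidence radius `β(s, a, s')`; `L` is the logarithmic factor. -/
def beta {H k : ℕ} (L : ℝ) (η : Fin k → Traj S A H) (s : S) (a : A) (s' : S) : ℝ :=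
  Real.sqrt (4 * (empModel η s a s' * (1 - empModel η s a s')) * L /
      (max (count η s a) 1 : ℕ)) +
    14 * L / (3 * (max (count η s a) 1 : ℕ))

/-- `β̄(s, a) = ∑_{s'} β(s, a, s')`. -/
def betaBar {H k : ℕ} (L : ℝ) (η : Fin k → Traj S A H) (s : S) (a : A) : ℝ :=
  ∑ s' : S, beta L η s a s'

/-- The set of models that are compatible with the observations. -/
def confSet {H k : ℕ} (L : ℝ) (η : Fin k → Traj S A H) : Set (Model S A) :=
  {P' | ∀ s a s', |P'.1 s a s' - empModel η s a s'| ≤ beta L η s a s'}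

/-! ### CMDPs, the optimistic-pessimistic problem and the algorithm -/

/-- A finite constrained MDP with costs in `[0, 1]` and a fixed initial state. -/
structure CMDP (S A : Type*) [Fintype S] where
  /-- objective cost -/
  r : S → A → ℝ
  /-- constraint cost -/
  c : S → A → ℝ
  /-- true transition probabilities -/
  P : Model S A
  /-- initial state -/
  s₁ : S
  /-- maximum permissible expected cumulative constraint cost -/
  Cbar : ℝ
  r_mem : ∀ s a, r s a ∈ Set.Icc (0 : ℝ) 1
  c_mem : ∀ s a, c s a ∈ Set.Icc (0 : ℝ) 1

/-- A policy is safe if `V_c^π(P) ≤ C̄` in the true model `P`. -/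
def CMDP.Safe {H : ℕ} (M : CMDP S A) (π : Policy S A H) : Prop :=
  value M.c π M.P M.s₁ ≤ M.Cbar

/-- The pessimistic constraint cost `c + H β̄`. -/
def CMDP.pessCost {H k : ℕ} (M : CMDP S A) (L : ℝ) (η : Fin k → Traj S A H) (s : S) (a : A) :
    ℝ :=
  M.c s a + H * betaBar L η s a

/-- The optimistic objective cost `r - H² / (C̄ - C̄_b) β̄`. -/
def CMDP.optCost {H k : ℕ} (M : CMDP S A) (Cb L : ℝ) (η : Fin k → Traj S A H) (s : S) (a : A) :
    ℝ :=
  M.r s a - (H : ℝ) ^ 2 / (M.Cbar - Cb) * betaBar L η s a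

/-- The feasible set of the optimistic-pessimistic problem. -/
def CMDP.opFeasible {H k : ℕ} (M : CMDP S A) (L : ℝ) (η : Fin k → Traj S A H) :
    Set (Policy S A H × Model S A) :=
  {x | x.2 ∈ confSet L η ∧ value (M.pessCost L η) x.1 x.2 M.s₁ ≤ M.Cbar}

/-- The solutions (minimizers) of the optimistic-pessimistic problem. -/
def CMDP.opSolutions {H k : ℕ} (M : CMDP S A) (Cb L : ℝ) (η : Fin k → Traj S A H) :
    Set (Policy S A H × Model S A) :=
  {x | x ∈ M.opFeasible L η ∧ ∀ y ∈ M.opFeasible L η,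
    value (M.optCost Cb L η) x.1 x.2 M.s₁ ≤ value (M.optCost Cb L η) y.1 y.2 M.s₁}

/-- The rule `ρ` is an instance of the algorithm with `K` episodes: in the episodes with number
at most `Ko` it plays the baseline policy, and in every later one the policy part of a solution
of the optimistic-pessimistic problem. Ties are broken in any way, and nothing is required
where that problem is infeasible. -/
structure IsOPSRL {H : ℕ} (M : CMDP S A) (K : ℕ) (δ Cb : ℝ) (πb : Policy S A H) (Ko : ℕ)
    (ρ : Rule S A H) : Prop where
  baseline : ∀ k < K, k + 1 ≤ Ko → ∀ η : Fin k → Traj S A H, ρ k η = πb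
  solve : ∀ k < K, Ko < k + 1 → ∀ η : Fin k → Traj S A H,
    (M.opFeasible (logTerm S A H K δ) η).Nonempty →
      ∃ P' : Model S A, (ρ k η, P') ∈ M.opSolutions Cb (logTerm S A H K δ) η

end OPSRL

end

noncomputable section

namespace OPSRL

set_option linter.unusedSectionVars false

variable {S A : Type*} [Fintype S] [DecidableEq S] [Fintype A] [DecidableEq A]

theorem kl_lower_bound {q p : ℝ} (hq : 0 ≤ q) (hqp : q < p) (hp : p < 1) :
    (p - q) ^ 2 / (2 * (q * (1 - q)) + 4 / 3 * (p - q)) ≤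
      q * Real.log (q / p) + (1 - q) * Real.log ((1 - q) / (1 - p)) := by
  have hp0 : 0 < p := hq.trans_lt hqp
  rcases hq.eq_or_lt with rfl | hq
  · have h : Real.log (1 - p) ≤ (1 - p) - 1 := Real.log_le_sub_one_of_pos (by linarith)
    have e : (p - 0) ^ 2 / (2 * (0 * (1 - 0)) + 4 / 3 * (p - 0)) = 3 / 4 * p := by
      field_simp
      ring
    rw [e, zero_mul, sub_zero, one_div, Real.log_inv]
    linarith
  let f : ℝ → ℝ := fun t => q * (Real.log q - Real.log t) +
    (1 - q) * (Real.log (1 - q) - Real.log (1 - t)) -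
      (t - q) ^ 2 / (2 * (q * (1 - q)) + 4 / 3 * (t - q))
  have hv : 0 < q * (1 - q) := mul_pos hq (by linarith)
  have hd : ∀ t ∈ Set.Icc q p, HasDerivAt f
      (q * (0 - t⁻¹) + (1 - q) * (0 - (-1) / (1 - t)) -
        (2 * (t - q) * (2 * (q * (1 - q)) + 4 / 3 * (t - q)) - (t - q) ^ 2 * (4 / 3)) /
          (2 * (q * (1 - q)) + 4 / 3 * (t - q)) ^ 2) t := by
    intro t ht
    have h0 : t ≠ 0 := by linarith [ht.1]
    have h1 : 1 - t ≠ 0 := by linarith [ht.2]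
    have h2 : 2 * (q * (1 - q)) + 4 / 3 * (t - q) ≠ 0 := by nlinarith [ht.1]
    have l1 : HasDerivAt (fun t : ℝ => 1 - t) (-1) t := by
      simpa using (hasDerivAt_id t).const_sub 1
    have l2 : HasDerivAt (fun t : ℝ => t - q) 1 t := (hasDerivAt_id t).sub_const q
    have l3 : HasDerivAt (fun t : ℝ => (t - q) ^ 2) (2 * (t - q)) t := by
      simpa using l2.fun_pow 2
    have l4 : HasDerivAt (fun t : ℝ => 2 * (q * (1 - q)) + 4 / 3 * (t - q)) (4 / 3) t := by
      simpa using (l2.const_mul (4 / 3)).const_add (2 * (q * (1 - q)))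
    have l5 := (((hasDerivAt_const t (Real.log q)).sub (Real.hasDerivAt_log h0)).const_mul q).add
      (((hasDerivAt_const t (Real.log (1 - q))).sub (l1.log h1)).const_mul (1 - q))
    exact l5.sub (l3.div l4 h2)
  have hmono : MonotoneOn f (Set.Icc q p) := by
    refine monotoneOn_of_deriv_nonneg (convex_Icc q p)
      (fun t ht => (hd t ht).continuousAt.continuousWithinAt)
      (fun t ht => (hd t (interior_subset ht)).differentiableAt.differentiableWithinAt) ?_
    intro t ht
    have ht := interior_subset ht
    rw [(hd t ht).deriv]
    have h0 : 0 < t := by linarith [ht.1]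
    have h1 : 0 < 1 - t := by linarith [ht.2]
    have hd0 : 0 ≤ t - q := by linarith [ht.1]
    have e1 : q * (0 - t⁻¹) + (1 - q) * (0 - (-1) / (1 - t)) = (t - q) / (t * (1 - t)) := by
      field_simp
      ring
    rw [e1, sub_nonneg, div_le_div_iff₀ (by positivity) (by positivity)]
    have hle : t * (1 - t) ≤ q * (1 - q) + (t - q) := by nlinarith
    generalize q * (1 - q) = v at *
    generalize t - q = d at *
    have hY : 0 ≤ 4 * v + 4 / 3 * d := by positivity
    calc _ = d * ((4 * v + 4 / 3 * d) * (t * (1 - t))) := by ring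
      _ ≤ d * ((4 * v + 4 / 3 * d) * (v + d)) := by gcongr
      _ ≤ d * (2 * v + 4 / 3 * d) ^ 2 := by
        refine mul_le_mul_of_nonneg_left ?_ hd0
        nlinarith [sq_nonneg d]
  have h := hmono ⟨le_refl q, hqp.le⟩ ⟨hqp.le, le_refl p⟩ hqp.le
  have h1 : f q = 0 := by simp [f]
  rw [h1] at h
  rw [Real.log_div hq.ne' hp0.ne', Real.log_div (by linarith) (by linarith)]
  simp only [f] at h
  linarith

/-- Chernoff weights for the lower tail of a binomial variable, relative to an empirical
Bernstein radius. -/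
theorem exists_lower_weights {n : ℕ} (hn : 0 < n) {p L : ℝ} (hp0 : 0 ≤ p) (hp1 : p ≤ 1)
    (hL : 0 ≤ L) :
    ∃ u v : ℝ, 0 ≤ u ∧ 0 ≤ v ∧ p * u + (1 - p) * v ≤ 1 ∧
      ∀ m b : ℕ, m + b = n →
        √(4 * ((m / n : ℝ) * (1 - m / n)) * L / n) + 14 * L / (3 * n) < p - m / n →
        Real.exp (2 * L) ≤ u ^ m * v ^ b := by
  classical
  let F : Finset ℕ := (Finset.range (n + 1)).filter fun m =>
    √(4 * ((m / n : ℝ) * (1 - m / n)) * L / n) + 14 * L / (3 * n) < p - m / n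
  have hn' : (0 : ℝ) < n := by exact_mod_cast hn
  rcases F.eq_empty_or_nonempty with hF | hF
  · refine ⟨1, 1, zero_le_one, zero_le_one, by linarith, fun m b hmb h => ?_⟩
    have : m ∈ F := Finset.mem_filter.2 ⟨Finset.mem_range.2 (by omega), h⟩
    rw [hF] at this
    simp at this
  obtain ⟨M, hMF, hmax⟩ : ∃ M ∈ F, ∀ m ∈ F, m ≤ M := ⟨F.max' hF, F.max'_mem hF, F.le_max'⟩
  have hM := (Finset.mem_filter.1 hMF).2
  have hMn : M ≤ n := by have := Finset.mem_range.1 (Finset.mem_filter.1 hMF).1; omega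
  set q : ℝ := M / n with hq
  have hq0 : 0 ≤ q := by positivity
  have hqp : q < p := by
    have : 0 ≤ √(4 * (q * (1 - q)) * L / n) + 14 * L / (3 * n) := by positivity
    linarith
  have hMlt : M < n := by
    have : q < 1 := by linarith
    rw [hq, div_lt_one hn'] at this
    exact_mod_cast this
  rcases hp1.eq_or_lt with rfl | hp1
  · refine ⟨1, Real.exp (2 * L), zero_le_one, (Real.exp_pos _).le, by linarith, ?_⟩
    intro m b hmb h
    have hm := hmax m (Finset.mem_filter.2 ⟨Finset.mem_range.2 (by omega), h⟩)
    rw [one_pow, one_mul]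
    exact le_self_pow₀ (Real.one_le_exp (by linarith)) (by omega)
  have hp : 0 < p := by linarith
  refine ⟨q / p, (1 - q) / (1 - p), by positivity,
    div_nonneg (by linarith) (by linarith), ?_, ?_⟩
  · have : 1 - p ≠ 0 := by linarith
    have : p * (q / p) + (1 - p) * ((1 - q) / (1 - p)) = 1 := by
      field_simp
      ring
    exact this.le
  intro m b hmb h
  have hm := hmax m (Finset.mem_filter.2 ⟨Finset.mem_range.2 (by omega), h⟩)
  have hu0 : 0 ≤ q / p := by positivity
  have hu1 : q / p ≤ 1 := (div_le_one hp).2 hqp.le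
  have hv1 : 1 ≤ (1 - q) / (1 - p) := (one_le_div (by linarith)).2 (by linarith)
  have hstep : (q / p) ^ M * ((1 - q) / (1 - p)) ^ (n - M) ≤
      (q / p) ^ m * ((1 - q) / (1 - p)) ^ b :=
    mul_le_mul (pow_le_pow_of_le_one hu0 hu1 hm) (pow_le_pow_right₀ hv1 (by omega))
      (by positivity) (by positivity)
  refine le_trans ?_ hstep
  have hexp : (q / p) ^ M * ((1 - q) / (1 - p)) ^ (n - M) =
      Real.exp (n * (q * Real.log (q / p) + (1 - q) * Real.log ((1 - q) / (1 - p)))) := by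
    have e1 : (n : ℝ) * q = M := by rw [hq]; field_simp
    have e2 : (n : ℝ) * (1 - q) = (n - M : ℕ) := by
      rw [Nat.cast_sub hMn, mul_sub, e1, mul_one]
    have e3 : (q / p) ^ M = Real.exp (M * Real.log (q / p)) := by
      rcases Nat.eq_zero_or_pos M with h0 | h0
      · simp [h0]
      · have : 0 < q / p := div_pos (div_pos (by exact_mod_cast h0) hn') hp
        rw [Real.exp_nat_mul, Real.exp_log this]
    rw [mul_add, ← mul_assoc, ← mul_assoc, e1, e2, Real.exp_add, ← e3, Real.exp_nat_mul,
      Real.exp_log (by linarith)]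
  rw [hexp, Real.exp_le_exp]
  have hkl := kl_lower_bound hq0 hqp hp1
  refine le_trans ?_ (mul_le_mul_of_nonneg_left hkl hn'.le)
  have hd : 0 < p - q := by linarith
  have hvar : 0 ≤ q * (1 - q) := mul_nonneg hq0 (by linarith)
  rw [mul_div_assoc', le_div_iff₀ (by positivity)]
  have hsq := Real.sq_sqrt (show 0 ≤ 4 * (q * (1 - q)) * L / n by positivity)
  have hs0 := Real.sqrt_nonneg (4 * (q * (1 - q)) * L / n)
  set z := √(4 * (q * (1 - q)) * L / n)
  have h14 : 0 ≤ 14 * L / (3 * n) := by positivity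
  have hmain : z ^ 2 + 14 * L / (3 * n) * (p - q) ≤ (p - q) ^ 2 := by nlinarith
  have hmul := mul_le_mul_of_nonneg_left hmain hn'.le
  rw [hsq] at hmul
  have e : (n : ℝ) * (4 * (q * (1 - q)) * L / n + 14 * L / (3 * n) * (p - q)) =
      4 * (q * (1 - q)) * L + 14 / 3 * L * (p - q) := by
    field_simp
  rw [e] at hmul
  nlinarith [mul_nonneg hL hd.le]

theorem exists_upper_weights {n : ℕ} (hn : 0 < n) {p L : ℝ} (hp0 : 0 ≤ p) (hp1 : p ≤ 1)
    (hL : 0 ≤ L) :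
    ∃ u v : ℝ, 0 ≤ u ∧ 0 ≤ v ∧ p * u + (1 - p) * v ≤ 1 ∧
      ∀ m b : ℕ, m + b = n →
        √(4 * ((m / n : ℝ) * (1 - m / n)) * L / n) + 14 * L / (3 * n) < m / n - p →
        Real.exp (2 * L) ≤ u ^ m * v ^ b := by
  obtain ⟨u, v, hu, hv, h1, h2⟩ := exists_lower_weights hn (p := 1 - p) (by linarith)
    (by linarith) hL
  refine ⟨v, u, hv, hu, by linarith, fun m b hmb h => ?_⟩
  have e : (b / n : ℝ) = 1 - m / n := by
    have : (0 : ℝ) < n := by exact_mod_cast hn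
    rw [← hmb] at this ⊢
    push_cast at this ⊢
    field_simp
    ring
  rw [mul_comm (v ^ m)]
  refine h2 b m (by omega) ?_
  rw [e]
  convert h using 1
  · congr 3
    ring
  · ring

/-- The policy for the remaining steps after the first one. -/
def Policy.tail {H : ℕ} (π : Policy S A (H + 1)) : Policy S A H :=
  ⟨fun h => π.1 h.succ, fun h s => π.2 h.succ s⟩

theorem trajMass_toReal {H : ℕ} (P : Model S A) (π : Policy S A H) (s₁ : S) (τ : Traj S A H) :
    (trajMass P π s₁ τ).toReal = (if τ.1 0 = s₁ then 1 else 0) *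
      ∏ h : Fin H, π.1 h (τ.1 h.castSucc) (τ.2 h) *
        P.1 (τ.1 h.castSucc) (τ.2 h) (τ.1 h.succ) := by
  unfold trajMass
  rw [ENNReal.toReal_mul, ENNReal.toReal_prod]
  congr 1
  · split_ifs <;> simp
  · refine Finset.prod_congr rfl fun h _ => ?_
    rw [ENNReal.toReal_mul, ENNReal.toReal_ofReal ((π.2 _ _).1 _),
      ENNReal.toReal_ofReal ((P.2 _ _).1 _)]

theorem sum_trajMass_toReal {H : ℕ} (P : Model S A) (π : Policy S A H) (s₁ : S) :
    ∑ τ : Traj S A H, (trajMass P π s₁ τ).toReal = 1 := by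
  have h := sum_trajMass P π s₁
  rw [← ENNReal.toReal_sum, h, ENNReal.toReal_one]
  intro τ _ hτ
  have := Finset.single_le_sum (f := trajMass P π s₁) (fun _ _ => zero_le)
    (Finset.mem_univ τ)
  rw [h, hτ] at this
  exact absurd this (by simp)

theorem sum_trajMass_mul_init {H : ℕ} (P : Model S A) (π : Policy S A H) (s₁ : S)
    (Φ : S → Traj S A H → ℝ) :
    ∑ τ, (trajMass P π s₁ τ).toReal * Φ (τ.1 0) τ =
      ∑ τ, (trajMass P π s₁ τ).toReal * Φ s₁ τ := by
  refine Finset.sum_congr rfl fun τ _ => ?_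
  by_cases h : τ.1 0 = s₁
  · rw [h]
  · simp [trajMass, h]

theorem sum_trajMass_succ {H : ℕ} (P : Model S A) (π : Policy S A (H + 1)) (s₁ : S)
    (Φ : Traj S A (H + 1) → ℝ) :
    ∑ τ, (trajMass P π s₁ τ).toReal * Φ τ =
      ∑ a, π.1 0 s₁ a * ∑ s', P.1 s₁ a s' * ∑ τ : Traj S A H,
        (trajMass P π.tail s' τ).toReal *
          Φ ((Fin.cons s₁ τ.1 : Fin (H + 2) → S), (Fin.cons a τ.2 : Fin (H + 1) → A)) := by
  rw [Fintype.sum_prod_type, ← (Fin.consEquiv (fun _ => S)).sum_comp, Fintype.sum_prod_type]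
  simp_rw [← (Fin.consEquiv (fun _ : Fin (H + 1) => A)).sum_comp, Fintype.sum_prod_type]
  have e : ∀ (x : S) (y : Fin (H + 1) → S) (a : A) (b : Fin H → A),
      (trajMass P π s₁ ((Fin.consEquiv (fun _ => S)) (x, y),
        (Fin.consEquiv (fun _ : Fin (H + 1) => A)) (a, b))).toReal =
      (if x = s₁ then 1 else 0) * (π.1 0 x a * (P.1 x a (y 0) *
        (trajMass P π.tail (y 0) (y, b)).toReal)) := by
    intro x y a b
    simp only [trajMass_toReal, Fin.consEquiv, Equiv.coe_fn_mk, Fin.prod_univ_succ,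
      Fin.cons_zero, Fin.castSucc_zero, Fin.cons_succ, ← Fin.succ_castSucc, Policy.tail,
      if_true, one_mul]
    ring
  simp_rw [e]
  rw [Finset.sum_eq_single s₁ (by intro x _ hx; simp [hx]) (by simp)]
  simp only [if_true, one_mul, Fin.consEquiv, Equiv.coe_fn_mk]
  rw [Finset.sum_comm]
  refine Finset.sum_congr rfl fun a _ => ?_
  have h2 : ∀ (y : Fin (H + 1) → S) (b : Fin H → A),
      P.1 s₁ a (y 0) * (trajMass P π.tail (y 0) (y, b)).toReal =
      ∑ s', P.1 s₁ a s' * (trajMass P π.tail s' (y, b)).toReal := by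
    intro y b
    rw [Finset.sum_eq_single (y 0)]
    · intro s' _ hs
      simp [trajMass, Ne.symm hs]
    · simp
  simp_rw [h2, Finset.mul_sum, Finset.sum_mul]
  rw [Finset.sum_comm' (t' := Finset.univ) (s' := fun _ => Finset.univ) (by simp)]
  conv_rhs => rw [Finset.sum_comm]
  rw [Finset.sum_comm]
  refine Finset.sum_congr rfl fun y _ => ?_
  conv_rhs => rw [Finset.sum_comm]
  refine Finset.sum_congr rfl fun b _ => Finset.sum_congr rfl fun s' _ => ?_
  ring

theorem value_eq {H : ℕ} (l : S → A → ℝ) (π : Policy S A H) (P : Model S A) (s₁ : S) :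
    value l π P s₁ = ∑ τ : Traj S A H, (trajMass P π s₁ τ).toReal *
      ∑ h : Fin H, l (τ.1 h.castSucc) (τ.2 h) := rfl

theorem value_zero (l : S → A → ℝ) (π : Policy S A 0) (P : Model S A) (s₁ : S) :
    value l π P s₁ = 0 := by
  simp [value]

/-- The Bellman recursion for the value of a policy. -/
theorem value_succ {H : ℕ} (l : S → A → ℝ) (π : Policy S A (H + 1)) (P : Model S A) (s₁ : S) :
    value l π P s₁ =
      ∑ a, π.1 0 s₁ a * (l s₁ a + ∑ s', P.1 s₁ a s' * value l π.tail P s') := by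
  rw [value_eq, sum_trajMass_succ]
  refine Finset.sum_congr rfl fun a _ => ?_
  congr 1
  have e : ∀ s', ∑ τ : Traj S A H, (trajMass P π.tail s' τ).toReal *
      ∑ h : Fin (H + 1), l ((Fin.cons s₁ τ.1 : Fin (H + 2) → S) h.castSucc)
        ((Fin.cons a τ.2 : Fin (H + 1) → A) h) = l s₁ a + value l π.tail P s' := by
    intro s'
    simp only [Fin.sum_univ_succ, Fin.cons_zero, Fin.castSucc_zero, Fin.cons_succ,
      ← Fin.succ_castSucc, mul_add, Finset.sum_add_distrib, ← Finset.sum_mul,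
      sum_trajMass_toReal, one_mul, value_eq]
  simp only [e, mul_add, Finset.sum_add_distrib, ← Finset.sum_mul, (P.2 s₁ a).2, one_mul]

theorem value_mem_Icc {H : ℕ} {l : S → A → ℝ} (hl : ∀ s a, l s a ∈ Set.Icc (0 : ℝ) 1)
    (π : Policy S A H) (P : Model S A) (s₁ : S) :
    value l π P s₁ ∈ Set.Icc (0 : ℝ) H := by
  rw [value_eq]
  constructor
  · exact Finset.sum_nonneg fun τ _ => mul_nonneg ENNReal.toReal_nonneg
      (Finset.sum_nonneg fun h _ => (hl _ _).1)
  · calc _ ≤ ∑ τ : Traj S A H, (trajMass P π s₁ τ).toReal * (H : ℝ) := by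
          refine Finset.sum_le_sum fun τ _ =>
            mul_le_mul_of_nonneg_left ?_ ENNReal.toReal_nonneg
          calc _ ≤ ∑ _h : Fin H, (1 : ℝ) := Finset.sum_le_sum fun h _ => (hl _ _).2
            _ = H := by simp
      _ = H := by rw [← Finset.sum_mul, sum_trajMass_toReal, one_mul]

/-- Pessimism: increasing the cost by the model error makes the value in another model an upper
bound of the value. -/
theorem value_le_value_add {H : ℕ} {c b : S → A → ℝ} (hc : ∀ s a, c s a ∈ Set.Icc (0 : ℝ) 1)
    {P P' : Model S A} (hb : ∀ s a, ∑ s', |P.1 s a s' - P'.1 s a s'| ≤ 2 * b s a)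
    {N : ℕ} (hN : H ≤ N) (π : Policy S A H) (s₁ : S) :
    value c π P s₁ ≤ value (fun s a => c s a + N * b s a) π P' s₁ := by
  induction H generalizing s₁ with
  | zero => simp [value_zero]
  | succ H ih =>
    rw [value_succ, value_succ]
    refine Finset.sum_le_sum fun a _ => mul_le_mul_of_nonneg_left ?_ ((π.2 _ _).1 _)
    have hHN : (H : ℝ) ≤ N := by exact_mod_cast (by omega : H ≤ N)
    have h1 : ∑ s', (P.1 s₁ a s' - P'.1 s₁ a s') * value c π.tail P s' ≤ N * b s₁ a := by
      have e : ∑ s', (P.1 s₁ a s' - P'.1 s₁ a s') * value c π.tail P s' =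
          ∑ s', (P.1 s₁ a s' - P'.1 s₁ a s') * (value c π.tail P s' - N / 2) := by
        simp only [mul_sub, Finset.sum_sub_distrib, ← Finset.sum_mul, sub_mul, (P.2 s₁ a).2,
          (P'.2 s₁ a).2]
        ring
      rw [e]
      calc _ ≤ ∑ s', |P.1 s₁ a s' - P'.1 s₁ a s'| * (N / 2) := by
            refine Finset.sum_le_sum fun s' _ => ?_
            refine (le_abs_self _).trans ?_
            rw [abs_mul]
            refine mul_le_mul_of_nonneg_left ?_ (abs_nonneg _)
            have := value_mem_Icc hc π.tail P s'
            rw [abs_le]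
            constructor <;> linarith [this.1, this.2]
        _ ≤ 2 * b s₁ a * (N / 2) := by
            rw [← Finset.sum_mul]
            exact mul_le_mul_of_nonneg_right (hb s₁ a) (by positivity)
        _ = N * b s₁ a := by ring
    have h2 : ∑ s', P'.1 s₁ a s' * value c π.tail P s' ≤
        ∑ s', P'.1 s₁ a s' * value (fun s a => c s a + N * b s a) π.tail P' s' :=
      Finset.sum_le_sum fun s' _ =>
        mul_le_mul_of_nonneg_left (ih (by omega) π.tail s') ((P'.2 _ _).1 _)
    simp only [sub_mul, Finset.sum_sub_distrib] at h1
    linarith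

/-- A product of step weights whose conditional means are at most one has mean at most one. -/
theorem sum_trajMass_prod_le_one {H : ℕ} {P : Model S A} {g : S → A → S → ℝ}
    (hg : ∀ s a s', 0 ≤ g s a s') (h1 : ∀ s a, ∑ s', P.1 s a s' * g s a s' ≤ 1)
    (π : Policy S A H) (s₁ : S) :
    ∑ τ, (trajMass P π s₁ τ).toReal *
      ∏ h : Fin H, g (τ.1 h.castSucc) (τ.2 h) (τ.1 h.succ) ≤ 1 := by
  induction H generalizing s₁ with
  | zero => simp [sum_trajMass_toReal]
  | succ H ih =>
    rw [sum_trajMass_succ]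
    calc _ ≤ ∑ a, π.1 0 s₁ a * 1 := by
          refine Finset.sum_le_sum fun a _ => mul_le_mul_of_nonneg_left ?_ ((π.2 _ _).1 _)
          refine le_trans (Finset.sum_le_sum fun s' _ =>
            mul_le_mul_of_nonneg_left ?_ ((P.2 _ _).1 _)) (h1 s₁ a)
          simp only [Fin.prod_univ_succ, Fin.cons_zero, Fin.castSucc_zero, Fin.cons_succ,
            ← Fin.succ_castSucc]
          rw [sum_trajMass_mul_init P π.tail s' (fun x τ => g s₁ a x *
            ∏ h : Fin H, g (τ.1 h.castSucc) (τ.2 h) (τ.1 h.succ))]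
          have e : ∀ x y z : ℝ, x * (y * z) = y * (x * z) := fun x y z => by ring
          simp_rw [e, ← Finset.mul_sum]
          exact mul_le_of_le_one_right (hg _ _ _) (ih π.tail s')
      _ = 1 := by simp [(π.2 0 s₁).2]

theorem runMass_toReal {H K : ℕ} (P : Model S A) (s₁ : S) (ρ : Rule S A H)
    (ω : Fin K → Traj S A H) :
    (runMass P s₁ ρ ω).toReal =
      ∏ k : Fin K, (trajMass P (ρ k (past ω k)) s₁ (ω k)).toReal :=
  ENNReal.toReal_prod _ _

theorem sum_runMass_prod_le_one {H : ℕ} (K : ℕ) {P : Model S A} {s₁ : S} {ρ : Rule S A H}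
    {G : ℕ → Traj S A H → ℝ} (hG : ∀ k τ, 0 ≤ G k τ)
    (h1 : ∀ k < K, ∀ η : Fin k → Traj S A H,
      ∑ τ, (trajMass P (ρ k η) s₁ τ).toReal * G k τ ≤ 1) :
    ∑ ω : Fin K → Traj S A H, (runMass P s₁ ρ ω).toReal * ∏ k : Fin K, G k (ω k) ≤ 1 := by
  induction K with
  | zero => simp [runMass]
  | succ K ih =>
    rw [← (Fin.snocEquiv (fun _ => Traj S A H)).sum_comp, Fintype.sum_prod_type,
      Finset.sum_comm]
    have e : ∀ (y : Fin K → Traj S A H) (x : Traj S A H),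
        (runMass P s₁ ρ ((Fin.snocEquiv (fun _ => Traj S A H)) (x, y))).toReal *
          ∏ k : Fin (K + 1), G k ((Fin.snocEquiv (fun _ => Traj S A H)) (x, y) k) =
        (runMass P s₁ ρ y).toReal * (∏ k : Fin K, G k (y k)) *
          ((trajMass P (ρ K y) s₁ x).toReal * G K x) := by
      intro y x
      have h1 : ∀ k : Fin K, past ((Fin.snocEquiv (fun _ => Traj S A H)) (x, y)) k.castSucc =
          past y k := by
        intro k
        funext j
        exact Fin.snoc_castSucc (α := fun _ => Traj S A H) x y (j.castLE k.isLt.le)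
      have h2 : past ((Fin.snocEquiv (fun _ => Traj S A H)) (x, y)) (Fin.last K) = y := by
        funext j
        exact Fin.snoc_castSucc (α := fun _ => Traj S A H) x y j
      have h3 : ∀ k : Fin K, (Fin.snocEquiv (fun _ => Traj S A H)) (x, y) k.castSucc = y k :=
        fun k => Fin.snoc_castSucc (α := fun _ => Traj S A H) x y k
      have h4 : (Fin.snocEquiv (fun _ => Traj S A H)) (x, y) (Fin.last K) = x :=
        Fin.snoc_last (α := fun _ => Traj S A H) x y
      rw [runMass_toReal, runMass_toReal, Fin.prod_univ_castSucc, Fin.prod_univ_castSucc, h4]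
      have e1 : (trajMass P (ρ (Fin.last K)
          (past ((Fin.snocEquiv (fun _ => Traj S A H)) (x, y)) (Fin.last K))) s₁ x).toReal =
          (trajMass P (ρ K y) s₁ x).toReal :=
        congrArg (fun z => (trajMass P (ρ K z) s₁ x).toReal) h2
      have e2 : ∀ k : Fin K, (trajMass P (ρ k.castSucc
          (past ((Fin.snocEquiv (fun _ => Traj S A H)) (x, y)) k.castSucc)) s₁ (y k)).toReal =
          (trajMass P (ρ k (past y k)) s₁ (y k)).toReal := fun k =>
        congrArg (fun z => (trajMass P (ρ k z) s₁ (y k)).toReal) (h1 k)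
      simp only [h3]
      rw [e1, Finset.prod_congr rfl fun k _ => e2 k]
      simp only [Fin.val_castSucc, Fin.val_last]
      ring
    simp_rw [e, ← Finset.mul_sum]
    calc _ ≤ ∑ y : Fin K → Traj S A H, (runMass P s₁ ρ y).toReal * ∏ k : Fin K, G k (y k) :=
          Finset.sum_le_sum fun y _ => mul_le_of_le_one_right
            (mul_nonneg ENNReal.toReal_nonneg (Finset.prod_nonneg fun k _ => hG _ _))
            (h1 K (by omega) y)
      _ ≤ 1 := ih fun k hk η => h1 k (by omega) η

theorem sum_runMass_toReal {H : ℕ} (K : ℕ) (P : Model S A) (s₁ : S) (ρ : Rule S A H) :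
    ∑ ω : Fin K → Traj S A H, (runMass P s₁ ρ ω).toReal = 1 := by
  have h := sum_runMass K P s₁ ρ
  rw [← ENNReal.toReal_sum, h, ENNReal.toReal_one]
  intro ω _ hω
  have := Finset.single_le_sum (f := runMass P s₁ ρ) (fun _ _ => zero_le)
    (Finset.mem_univ ω)
  rw [h, hω] at this
  exact absurd this (by simp)

open Classical in
theorem runProb_eq {H K : ℕ} (P : Model S A) (s₁ : S) (ρ : Rule S A H)
    (E : Set (Fin K → Traj S A H)) :
    runProb P s₁ ρ E = ∑ ω, if ω ∈ E then (runMass P s₁ ρ ω).toReal else 0 := by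
  unfold runProb
  have hle : ∀ ω : Fin K → Traj S A H, runMass P s₁ ρ ω ≠ ⊤ := by
    intro ω hω
    have := Finset.single_le_sum (f := runMass P s₁ ρ) (fun _ _ => zero_le)
      (Finset.mem_univ ω)
    rw [sum_runMass, hω] at this
    exact absurd this (by simp)
  rw [PMF.toOuterMeasure_apply_fintype, ENNReal.toReal_sum]
  · refine Finset.sum_congr rfl fun ω _ => ?_
    rw [Set.indicator_apply]
    split_ifs
    · rfl
    · rfl
  · intro ω _
    rw [Set.indicator_apply]
    split_ifs
    · exact hle ω
    · simp

theorem runProb_compl {H K : ℕ} (P : Model S A) (s₁ : S) (ρ : Rule S A H)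
    (E : Set (Fin K → Traj S A H)) :
    runProb P s₁ ρ E = 1 - runProb P s₁ ρ Eᶜ := by
  classical
  rw [eq_sub_iff_add_eq, runProb_eq, runProb_eq, ← Finset.sum_add_distrib,
    ← sum_runMass_toReal K P s₁ ρ]
  refine Finset.sum_congr rfl fun ω _ => ?_
  by_cases h : ω ∈ E <;> simp [h]

theorem runProb_mono {H K : ℕ} (P : Model S A) (s₁ : S) (ρ : Rule S A H)
    {E F : Set (Fin K → Traj S A H)} (h : E ⊆ F) : runProb P s₁ ρ E ≤ runProb P s₁ ρ F := by
  classical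
  rw [runProb_eq, runProb_eq]
  refine Finset.sum_le_sum fun ω _ => ?_
  by_cases h1 : ω ∈ E
  · simp [h1, h h1]
  · rw [if_neg h1]
    split_ifs
    exacts [ENNReal.toReal_nonneg, le_rfl]

theorem runProb_union_le {H K : ℕ} (P : Model S A) (s₁ : S) (ρ : Rule S A H)
    (E F : Set (Fin K → Traj S A H)) :
    runProb P s₁ ρ (E ∪ F) ≤ runProb P s₁ ρ E + runProb P s₁ ρ F := by
  classical
  simp only [runProb_eq]
  rw [← Finset.sum_add_distrib]
  refine Finset.sum_le_sum fun ω _ => ?_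
  have := ENNReal.toReal_nonneg (a := runMass P s₁ ρ ω)
  by_cases h1 : ω ∈ E <;> by_cases h2 : ω ∈ F <;> simp [h1, h2]

theorem runProb_iUnion_le {H K : ℕ} (P : Model S A) (s₁ : S) (ρ : Rule S A H)
    {ι : Type*} [Fintype ι] (E : ι → Set (Fin K → Traj S A H)) {ε : ℝ}
    (hε : ∀ i, runProb P s₁ ρ (E i) ≤ ε) :
    runProb P s₁ ρ (⋃ i, E i) ≤ Fintype.card ι * ε := by
  classical
  calc _ ≤ ∑ i, runProb P s₁ ρ (E i) := by
        simp only [runProb_eq]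
        rw [Finset.sum_comm]
        refine Finset.sum_le_sum fun ω _ => ?_
        have h0 : ∀ i ∈ Finset.univ, 0 ≤ if ω ∈ E i then (runMass P s₁ ρ ω).toReal else 0 := by
          intro i _
          split_ifs
          exacts [ENNReal.toReal_nonneg, le_rfl]
        split_ifs with h
        · obtain ⟨i, hi⟩ := Set.mem_iUnion.1 h
          refine le_trans ?_ (Finset.single_le_sum h0 (Finset.mem_univ i))
          rw [if_pos hi]
        · exact Finset.sum_nonneg h0
    _ ≤ ∑ _i : ι, ε := Finset.sum_le_sum fun i _ => hε i
    _ = _ := by simp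

/-- Markov's inequality for an exponential threshold. -/
theorem runProb_le_exp_neg {H K : ℕ} (P : Model S A) (s₁ : S) (ρ : Rule S A H)
    {E : Set (Fin K → Traj S A H)} {X : (Fin K → Traj S A H) → ℝ} {t : ℝ}
    (hX : ∀ ω, 0 ≤ X ω) (h1 : ∑ ω, (runMass P s₁ ρ ω).toReal * X ω ≤ 1)
    (hE : ∀ ω ∈ E, Real.exp t ≤ X ω) : runProb P s₁ ρ E ≤ Real.exp (-t) := by
  classical
  rw [Real.exp_neg, ← one_div, le_div_iff₀ (Real.exp_pos t), runProb_eq, Finset.sum_mul]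
  refine le_trans (Finset.sum_le_sum fun ω _ => ?_) h1
  split_ifs with h
  · exact mul_le_mul_of_nonneg_left (hE ω h) ENNReal.toReal_nonneg
  · rw [zero_mul]
    exact mul_nonneg ENNReal.toReal_nonneg (hX ω)

@[to_additive]
theorem prod_past {X N : Type*} [CommMonoid N] {K : ℕ} (ω : Fin K → X) (k : Fin K) (f : X → N) :
    ∏ j, f (past ω k j) = ∏ j : Fin K, if (j : ℕ) < k then f (ω j) else 1 := by
  rw [← Finset.prod_filter]
  refine Finset.prod_nbij (fun j => j.castLE k.isLt.le) ?_ ?_ ?_ ?_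
  · intro j _
    exact Finset.mem_filter.2 ⟨Finset.mem_univ _, j.isLt⟩
  · intro i _ j _ h
    simpa using h
  · intro j hj
    have hj : (j : ℕ) < k := by simpa using hj
    exact ⟨⟨j, hj⟩, by simp, rfl⟩
  · intro j _
    rfl

theorem count_le {H k : ℕ} (η : Fin k → Traj S A H) (s : S) (a : A) : count η s a ≤ k * H := by
  calc _ ≤ ∑ _j : Fin k, ∑ _h : Fin H, 1 :=
        Finset.sum_le_sum fun j _ => Finset.sum_le_sum fun h _ => by split_ifs <;> simp
    _ = k * H := by simp

theorem countNext_le_count {H k : ℕ} (η : Fin k → Traj S A H) (s : S) (a : A) (s' : S) :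
    countNext η s a s' ≤ count η s a := by
  refine Finset.sum_le_sum fun j _ => Finset.sum_le_sum fun h _ => ?_
  split_ifs <;> simp_all

theorem sum_countNext {H k : ℕ} (η : Fin k → Traj S A H) (s : S) (a : A) :
    ∑ s', countNext η s a s' = count η s a := by
  unfold countNext count
  rw [Finset.sum_comm]
  refine Finset.sum_congr rfl fun j _ => ?_
  rw [Finset.sum_comm]
  refine Finset.sum_congr rfl fun h _ => ?_
  by_cases h1 : (η j).1 h.castSucc = s ∧ (η j).2 h = a
  · simp [h1.1, h1.2]
  · rw [if_neg h1]
    refine Finset.sum_eq_zero fun s' _ => if_neg fun h2 => h1 ⟨h2.1, h2.2.1⟩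

/-- The factor `u` for a transition from `(s, a)` to `s'`, and `v` for one to another state. -/
def stepWeight (s : S) (a : A) (s' : S) (u v : ℝ) (x : S) (b : A) (x' : S) : ℝ :=
  if x = s ∧ b = a then (if x' = s' then u else v) else 1

theorem prod_stepWeight {H k : ℕ} (η : Fin k → Traj S A H) (s : S) (a : A) (s' : S) (u v : ℝ) :
    ∏ j, ∏ h : Fin H,
      stepWeight s a s' u v ((η j).1 h.castSucc) ((η j).2 h) ((η j).1 h.succ) =
        u ^ countNext η s a s' * v ^ (count η s a - countNext η s a s') := by
  have hc : count η s a - countNext η s a s' = ∑ j : Fin k, ∑ h : Fin H,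
      if (η j).1 h.castSucc = s ∧ (η j).2 h = a ∧ (η j).1 h.succ ≠ s' then 1 else 0 := by
    rw [Nat.sub_eq_iff_eq_add (countNext_le_count η s a s')]
    unfold count countNext
    simp only [← Finset.sum_add_distrib]
    refine Finset.sum_congr rfl fun j _ => Finset.sum_congr rfl fun h _ => ?_
    by_cases h1 : (η j).1 h.castSucc = s <;> by_cases h2 : (η j).2 h = a <;>
      by_cases h3 : (η j).1 h.succ = s' <;> simp [h1, h2, h3]
  rw [hc]
  unfold countNext
  simp only [← Finset.prod_pow_eq_pow_sum, ← Finset.prod_mul_distrib]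
  refine Finset.prod_congr rfl fun j _ => Finset.prod_congr rfl fun h _ => ?_
  unfold stepWeight
  by_cases h1 : (η j).1 h.castSucc = s <;> by_cases h2 : (η j).2 h = a <;>
    by_cases h3 : (η j).1 h.succ = s' <;> simp [h1, h2, h3]

theorem runProb_weight_le {H K : ℕ} (P : Model S A) (s₁ : S) (ρ : Rule S A H) (k : Fin K)
    (s : S) (a : A) (s' : S) {u v t : ℝ} (hu : 0 ≤ u) (hv : 0 ≤ v)
    (huv : P.1 s a s' * u + (1 - P.1 s a s') * v ≤ 1) :
    runProb P s₁ ρ {ω : Fin K → Traj S A H | Real.exp t ≤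
      u ^ countNext (past ω k) s a s' *
        v ^ (count (past ω k) s a - countNext (past ω k) s a s')} ≤ Real.exp (-t) := by
  have hw : ∀ x b x', 0 ≤ stepWeight s a s' u v x b x' := by
    intro x b x'
    unfold stepWeight
    split_ifs
    exacts [hu, hv, zero_le_one]
  let G : ℕ → Traj S A H → ℝ := fun j τ => if j < k then
    ∏ h : Fin H, stepWeight s a s' u v (τ.1 h.castSucc) (τ.2 h) (τ.1 h.succ) else 1
  have hG : ∀ j τ, 0 ≤ G j τ := by
    intro j τ
    simp only [G]
    split_ifs
    exacts [Finset.prod_nonneg fun h _ => hw _ _ _, zero_le_one]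
  have hstep : ∀ x b, ∑ x', P.1 x b x' * stepWeight s a s' u v x b x' ≤ 1 := by
    intro x b
    unfold stepWeight
    by_cases h : x = s ∧ b = a
    · rw [h.1, h.2]
      have e : ∀ x', P.1 s a x' * (if s = s ∧ a = a then (if x' = s' then u else v) else 1) =
          v * P.1 s a x' + if x' = s' then P.1 s a x' * (u - v) else 0 := by
        intro x'
        rw [if_pos ⟨rfl, rfl⟩]
        split_ifs <;> ring
      rw [Finset.sum_congr rfl fun x' _ => e x', Finset.sum_add_distrib, ← Finset.mul_sum,
        (P.2 s a).2, Finset.sum_ite_eq', if_pos (Finset.mem_univ _)]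
      linarith
    · simp only [if_neg h, mul_one, (P.2 x b).2, le_refl]
  refine runProb_le_exp_neg P s₁ ρ (X := fun ω => ∏ j : Fin K, G j (ω j))
    (fun ω => Finset.prod_nonneg fun j _ => hG _ _) (sum_runMass_prod_le_one K hG ?_) ?_
  · intro j _ η
    by_cases hj : j < k
    · simp only [G, if_pos hj]
      exact sum_trajMass_prod_le_one hw hstep _ _
    · simp only [G, if_neg hj, mul_one, sum_trajMass_toReal, le_refl]
  · intro ω hω
    refine le_of_le_of_eq hω ?_
    rw [← prod_stepWeight]
    exact prod_past ω k fun τ =>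
      ∏ h : Fin H, stepWeight s a s' u v (τ.1 h.castSucc) (τ.2 h) (τ.1 h.succ)

theorem beta_eq {H k : ℕ} (L : ℝ) {η : Fin k → Traj S A H} {s : S} {a : A} {n : ℕ}
    (hn : 0 < n) (hc : count η s a = n) (s' : S) :
    empModel η s a s' = (countNext η s a s' : ℝ) / n ∧
    beta L η s a s' = √(4 * ((countNext η s a s' / n : ℝ) * (1 - countNext η s a s' / n)) * L / n)
      + 14 * L / (3 * n) := by
  unfold beta empModel
  rw [hc, max_eq_left (by omega : 1 ≤ n)]
  exact ⟨rfl, rfl⟩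

theorem model_le_one (P : Model S A) (s : S) (a : A) (s' : S) : P.1 s a s' ≤ 1 := by
  rw [← (P.2 s a).2]
  exact Finset.single_le_sum (fun x _ => (P.2 s a).1 x) (Finset.mem_univ s')

theorem runProb_lower_deviation_le {H K : ℕ} (P : Model S A) (s₁ : S) (ρ : Rule S A H)
    (k : Fin K) (s : S) (a : A) (s' : S) {n : ℕ} (hn : 0 < n) {L : ℝ} (hL : 0 ≤ L) :
    runProb P s₁ ρ {ω : Fin K → Traj S A H | count (past ω k) s a = n ∧
      beta L (past ω k) s a s' < P.1 s a s' - empModel (past ω k) s a s'} ≤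
        Real.exp (-(2 * L)) := by
  obtain ⟨u, v, hu, hv, huv, h⟩ := exists_lower_weights hn ((P.2 s a).1 s')
    (model_le_one P s a s') hL
  refine le_trans (runProb_mono _ _ _ fun ω hω => ?_)
    (runProb_weight_le P s₁ ρ k s a s' hu hv huv)
  obtain ⟨h1, h2⟩ := hω
  rw [(beta_eq L hn h1 s').1, (beta_eq L hn h1 s').2] at h2
  have := countNext_le_count (past ω k) s a s'
  exact h _ _ (by omega) h2

theorem runProb_upper_deviation_le {H K : ℕ} (P : Model S A) (s₁ : S) (ρ : Rule S A H)
    (k : Fin K) (s : S) (a : A) (s' : S) {n : ℕ} (hn : 0 < n) {L : ℝ} (hL : 0 ≤ L) :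
    runProb P s₁ ρ {ω : Fin K → Traj S A H | count (past ω k) s a = n ∧
      beta L (past ω k) s a s' < empModel (past ω k) s a s' - P.1 s a s'} ≤
        Real.exp (-(2 * L)) := by
  obtain ⟨u, v, hu, hv, huv, h⟩ := exists_upper_weights hn ((P.2 s a).1 s')
    (model_le_one P s a s') hL
  refine le_trans (runProb_mono _ _ _ fun ω hω => ?_)
    (runProb_weight_le P s₁ ρ k s a s' hu hv huv)
  obtain ⟨h1, h2⟩ := hω
  rw [(beta_eq L hn h1 s').1, (beta_eq L hn h1 s').2] at h2
  have := countNext_le_count (past ω k) s a s'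
  exact h _ _ (by omega) h2

theorem one_half_le_logTerm [Nonempty S] [Nonempty A] {H K : ℕ} (hH : 0 < H) (hK : 0 < K)
    {δ : ℝ} (hδ : 0 < δ) (hδ1 : δ < 1) : 1 / 2 ≤ logTerm S A H K δ := by
  have h1 : (1 : ℝ) ≤ Fintype.card S := by exact_mod_cast Fintype.card_pos (α := S)
  have h2 : (1 : ℝ) ≤ Fintype.card A := by exact_mod_cast Fintype.card_pos (α := A)
  have h3 : (1 : ℝ) ≤ H := by exact_mod_cast hH
  have h4 : (1 : ℝ) ≤ K := by exact_mod_cast hK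
  have h5 : (2 : ℝ) ≤ 2 * Fintype.card S * Fintype.card A * H * K / δ := by
    rw [le_div_iff₀ hδ]
    calc 2 * δ ≤ 2 * 1 * 1 * 1 * 1 := by linarith
      _ ≤ _ := by gcongr
  have h6 := Real.log_le_log two_pos h5
  unfold logTerm
  linarith [Real.log_two_gt_d9]

theorem exp_neg_two_logTerm [Nonempty S] [Nonempty A] {H K : ℕ} (hH : 0 < H) (hK : 0 < K)
    {δ : ℝ} (hδ : 0 < δ) : Real.exp (-(2 * logTerm S A H K δ)) =
      (δ / (2 * Fintype.card S * Fintype.card A * H * K)) ^ 2 := by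
  have h1 : (0 : ℝ) < Fintype.card S := by exact_mod_cast Fintype.card_pos (α := S)
  have h2 : (0 : ℝ) < Fintype.card A := by exact_mod_cast Fintype.card_pos (α := A)
  have h3 : (0 : ℝ) < H := by exact_mod_cast hH
  have h4 : (0 : ℝ) < K := by exact_mod_cast hK
  have e : -(2 * logTerm S A H K δ) = (2 : ℕ) * (-logTerm S A H K δ) := by
    push_cast
    ring
  rw [e, Real.exp_nat_mul, Real.exp_neg, logTerm, Real.exp_log (by positivity), inv_div]

/-- With high probability the true model stays in the confidence set. -/
theorem runProb_notMem_confSet_le [Nonempty S] [Nonempty A] {H K : ℕ} (hH : 0 < H) (hK : 0 < K)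
    {δ : ℝ} (hδ : 0 < δ) (hδ1 : δ < 1) (P : Model S A) (s₁ : S) (ρ : Rule S A H) :
    runProb P s₁ ρ {ω : Fin K → Traj S A H |
      ∀ k, P ∈ confSet (logTerm S A H K δ) (past ω k)}ᶜ ≤ δ / 2 := by
  have hL := one_half_le_logTerm (S := S) (A := A) hH hK hδ hδ1
  have hexp := exp_neg_two_logTerm (S := S) (A := A) hH hK hδ
  set L := logTerm S A H K δ
  let E : Fin K × S × A × S × Fin (H * K) × Bool → Set (Fin K → Traj S A H) :=
    fun i => {ω | count (past ω i.1) i.2.1 i.2.2.1 = i.2.2.2.2.1 + 1 ∧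
      beta L (past ω i.1) i.2.1 i.2.2.1 i.2.2.2.1 <
        bif i.2.2.2.2.2 then
          P.1 i.2.1 i.2.2.1 i.2.2.2.1 - empModel (past ω i.1) i.2.1 i.2.2.1 i.2.2.2.1
        else empModel (past ω i.1) i.2.1 i.2.2.1 i.2.2.2.1 - P.1 i.2.1 i.2.2.1 i.2.2.2.1}
  have hE : ∀ i, runProb P s₁ ρ (E i) ≤ Real.exp (-(2 * L)) := by
    rintro ⟨k, s, a, s', n, _ | _⟩
    · exact runProb_upper_deviation_le P s₁ ρ k s a s' (Nat.succ_pos n) (by linarith)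
    · exact runProb_lower_deviation_le P s₁ ρ k s a s' (Nat.succ_pos n) (by linarith)
  have hsub : {ω : Fin K → Traj S A H | ∀ k, P ∈ confSet L (past ω k)}ᶜ ⊆ ⋃ i, E i := by
    intro ω hω
    simp only [Set.mem_compl_iff, Set.mem_ofPred_eq, confSet, not_forall, not_le] at hω
    obtain ⟨k, s, a, s', h⟩ := hω
    rcases Nat.eq_zero_or_pos (count (past ω k) s a) with h0 | h0
    · exfalso
      have h1 : countNext (past ω k) s a s' = 0 := by
        have := countNext_le_count (past ω k) s a s'
        omega
      simp only [beta, empModel, h0, h1] at h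
      norm_num at h
      rw [abs_of_nonneg ((P.2 s a).1 s')] at h
      linarith [model_le_one P s a s']
    · have hle := count_le (past ω k) s a
      have hlt : count (past ω k) s a - 1 < H * K := by
        have h2 : (k : ℕ) * H ≤ K * H := Nat.mul_le_mul_right H k.isLt.le
        rw [mul_comm H K]
        omega
      have hn : count (past ω k) s a = count (past ω k) s a - 1 + 1 := by omega
      rcases lt_abs.1 h with h | h
      · exact Set.mem_iUnion.2 ⟨(k, s, a, s', ⟨_, hlt⟩, true), hn, h⟩
      · refine Set.mem_iUnion.2 ⟨(k, s, a, s', ⟨_, hlt⟩, false), hn, ?_⟩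
        rw [neg_sub] at h
        exact h
  refine (runProb_mono _ _ _ hsub).trans ((runProb_iUnion_le P s₁ ρ E hE).trans ?_)
  rw [hexp]
  simp only [Fintype.card_prod, Fintype.card_fin, Fintype.card_bool]
  have h1 : (1 : ℝ) ≤ Fintype.card S := by exact_mod_cast Fintype.card_pos (α := S)
  have h2 : (1 : ℝ) ≤ Fintype.card A := by exact_mod_cast Fintype.card_pos (α := A)
  have h3 : (1 : ℝ) ≤ H := by exact_mod_cast hH
  have h4 : (1 : ℝ) ≤ K := by exact_mod_cast hK
  push_cast
  generalize (Fintype.card S : ℝ) = x at *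
  generalize (Fintype.card A : ℝ) = y at *
  generalize (H : ℝ) = h at *
  generalize (K : ℝ) = z at *
  have e : z * (x * (y * (x * (h * z * 2)))) * (δ / (2 * x * y * h * z)) ^ 2 =
      δ ^ 2 / (2 * (y * h)) := by
    field_simp
  rw [e, div_le_div_iff₀ (by positivity) two_pos]
  have : 1 ≤ y * h := one_le_mul_of_one_le_of_one_le h2 h3
  nlinarith [mul_pos hδ (sub_pos.2 hδ1), mul_nonneg hδ.le (sub_nonneg.2 this)]

theorem CMDP.safe_of_mem_confSet {H k : ℕ} {M : CMDP S A} {L : ℝ} {η : Fin k → Traj S A H}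
    (hP : M.P ∈ confSet L η) {x : Policy S A H × Model S A} (hx : x ∈ M.opFeasible L η) :
    M.Safe x.1 := by
  refine le_trans (value_le_value_add M.c_mem (b := betaBar L η) (P' := x.2) ?_ le_rfl x.1 M.s₁)
    hx.2
  intro s a
  unfold betaBar
  rw [Finset.mul_sum]
  refine Finset.sum_le_sum fun s' _ => ?_
  have h1 := hP s a s'
  have h2 := hx.1 s a s'
  rw [abs_le] at *
  constructor <;> linarith [h1.1, h1.2, h2.1, h2.2]

/-- The number of visits of `(s, a)` in one episode. -/
def visits {H : ℕ} (s : S) (a : A) (τ : Traj S A H) : ℕ :=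
  ∑ h : Fin H, if τ.1 h.castSucc = s ∧ τ.2 h = a then 1 else 0

/-- The expected number of visits of `(s, a)` in one episode. -/
def occupancy {H : ℕ} (P : Model S A) (π : Policy S A H) (s₁ : S) (s : S) (a : A) : ℝ :=
  ∑ τ, (trajMass P π s₁ τ).toReal * visits s a τ

theorem visits_le {H : ℕ} (s : S) (a : A) (τ : Traj S A H) : visits s a τ ≤ H := by
  calc _ ≤ ∑ _h : Fin H, 1 := Finset.sum_le_sum fun h _ => by split_ifs <;> simp
    _ = H := by simp

theorem occupancy_nonneg {H : ℕ} (P : Model S A) (π : Policy S A H) (s₁ : S) (s : S) (a : A) :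
    0 ≤ occupancy P π s₁ s a :=
  Finset.sum_nonneg fun _ _ => mul_nonneg ENNReal.toReal_nonneg (Nat.cast_nonneg _)

theorem value_eq_sum_occupancy {H : ℕ} (l : S → A → ℝ) (π : Policy S A H) (P : Model S A)
    (s₁ : S) : value l π P s₁ = ∑ s, ∑ a, occupancy P π s₁ s a * l s a := by
  have e : ∀ τ : Traj S A H, ∑ h : Fin H, l (τ.1 h.castSucc) (τ.2 h) =
      ∑ s, ∑ a, (visits s a τ : ℝ) * l s a := by
    intro τ
    unfold visits
    push_cast
    simp_rw [Finset.sum_mul]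
    have e1 : ∀ s, ∑ a, ∑ h : Fin H,
        (if τ.1 h.castSucc = s ∧ τ.2 h = a then (1 : ℝ) else 0) * l s a =
        ∑ h : Fin H, ∑ a, (if τ.1 h.castSucc = s ∧ τ.2 h = a then (1 : ℝ) else 0) * l s a :=
      fun s => Finset.sum_comm
    simp_rw [e1]
    rw [Finset.sum_comm]
    refine Finset.sum_congr rfl fun h _ => ?_
    simp [ite_and]
  rw [value_eq]
  simp_rw [e, occupancy, Finset.mul_sum, Finset.sum_mul]
  rw [Finset.sum_comm]
  refine Finset.sum_congr rfl fun s _ => ?_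
  rw [Finset.sum_comm]
  refine Finset.sum_congr rfl fun a _ => Finset.sum_congr rfl fun τ _ => ?_
  ring

theorem sum_occupancy {H : ℕ} (P : Model S A) (π : Policy S A H) (s₁ : S) :
    ∑ s, ∑ a, occupancy P π s₁ s a = H := by
  have h := value_eq_sum_occupancy (fun _ _ => 1) π P s₁
  rw [value_eq] at h
  simp only [mul_one, Finset.sum_const, Finset.card_univ, Fintype.card_fin, nsmul_eq_mul,
    ← Finset.sum_mul, sum_trajMass_toReal, one_mul] at h
  exact h.symm

theorem count_past {H K : ℕ} (ω : Fin K → Traj S A H) (k : Fin K) (s : S) (a : A) :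
    count (past ω k) s a = ∑ j : Fin K, if (j : ℕ) < k then visits s a (ω j) else 0 :=
  sum_past ω k (visits s a)

theorem exp_neg_le_one_sub_half {x : ℝ} (h0 : 0 ≤ x) (h1 : x ≤ 1) :
    Real.exp (-x) ≤ 1 - x / 2 := by
  have h := Real.add_one_le_exp x
  rw [Real.exp_neg, inv_le_comm₀ (Real.exp_pos x) (by linarith)]
  refine le_trans ?_ h
  rw [inv_le_iff_one_le_mul₀ (by linarith)]
  nlinarith

/-- Lower deviation of the number of visits in the episodes of a fixed policy. -/
theorem runProb_visits_lt_le {H K m : ℕ} (hH : 0 < H) (hm : m ≤ K) (P : Model S A) (s₁ : S)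
    {ρ : Rule S A H} {π : Policy S A H} (hρ : ∀ k < m, ∀ η, ρ k η = π) (s : S) (a : A) (L : ℝ) :
    runProb P s₁ ρ {ω : Fin K → Traj S A H |
      ((∑ j : Fin K, if (j : ℕ) < m then visits s a (ω j) else 0 : ℕ) : ℝ) <
        m * occupancy P π s₁ s a / 2 - 2 * H * L} ≤ Real.exp (-(2 * L)) := by
  have hH' : (0 : ℝ) < H := by exact_mod_cast hH
  set w := occupancy P π s₁ s a with hw
  let G : ℕ → Traj S A H → ℝ := fun j τ =>
    if j < m then Real.exp (w / (2 * H) - visits s a τ / H) else 1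
  have hG : ∀ j τ, 0 ≤ G j τ := by
    intro j τ
    simp only [G]
    split_ifs
    exacts [(Real.exp_pos _).le, zero_le_one]
  refine runProb_le_exp_neg P s₁ ρ (X := fun ω => ∏ j : Fin K, G j (ω j))
    (fun ω => Finset.prod_nonneg fun j _ => hG _ _) (sum_runMass_prod_le_one K hG ?_) ?_
  · intro j _ η
    by_cases hj : j < m
    · simp only [G, if_pos hj, hρ j hj η]
      have h1 : ∑ τ : Traj S A H, (trajMass P π s₁ τ).toReal *
          Real.exp (-(visits s a τ / H)) ≤ 1 - w / (2 * H) := by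
        calc _ ≤ ∑ τ : Traj S A H, (trajMass P π s₁ τ).toReal *
              (1 - (visits s a τ / H : ℝ) / 2) :=
              Finset.sum_le_sum fun τ _ => mul_le_mul_of_nonneg_left
                (exp_neg_le_one_sub_half (by positivity)
                  ((div_le_one hH').2 (by exact_mod_cast visits_le s a τ)))
                ENNReal.toReal_nonneg
          _ = ∑ τ : Traj S A H, ((trajMass P π s₁ τ).toReal -
              (trajMass P π s₁ τ).toReal * visits s a τ / (2 * H)) :=
              Finset.sum_congr rfl fun τ _ => by field_simp
          _ = 1 - w / (2 * H) := by
              rw [Finset.sum_sub_distrib, sum_trajMass_toReal, ← Finset.sum_div, hw, occupancy]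
      have h2 : ∀ τ : Traj S A H, (trajMass P π s₁ τ).toReal *
          Real.exp (w / (2 * H) - visits s a τ / H) = Real.exp (w / (2 * H)) *
            ((trajMass P π s₁ τ).toReal * Real.exp (-(visits s a τ / H))) := by
        intro τ
        rw [sub_eq_add_neg, Real.exp_add]
        ring
      rw [Finset.sum_congr rfl fun τ _ => h2 τ, ← Finset.mul_sum]
      have h3 : 1 - w / (2 * H) ≤ Real.exp (-(w / (2 * H))) := by
        have := Real.add_one_le_exp (-(w / (2 * H)))
        linarith
      calc _ ≤ Real.exp (w / (2 * H)) * Real.exp (-(w / (2 * H))) :=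
            mul_le_mul_of_nonneg_left (h1.trans h3) (Real.exp_pos _).le
        _ = 1 := by rw [← Real.exp_add, add_neg_cancel, Real.exp_zero]
    · simp only [G, if_neg hj, mul_one, sum_trajMass_toReal, le_refl]
  · intro ω hω
    have hω : ((∑ j : Fin K, if (j : ℕ) < m then visits s a (ω j) else 0 : ℕ) : ℝ) <
        m * w / 2 - 2 * H * L := hω
    have e : ∏ j : Fin K, G j (ω j) = Real.exp (∑ j : Fin K,
        if (j : ℕ) < m then w / (2 * H) - visits s a (ω j) / H else 0) := by
      rw [Real.exp_sum]
      refine Finset.prod_congr rfl fun j _ => ?_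
      simp only [G]
      split_ifs <;> simp
    have e2 : ∑ j : Fin K, (if (j : ℕ) < m then w / (2 * H) - visits s a (ω j) / H else 0) =
        m * (w / (2 * H)) -
          ((∑ j : Fin K, if (j : ℕ) < m then visits s a (ω j) else 0 : ℕ) : ℝ) / H := by
      have hcard : ((Finset.univ : Finset (Fin K)).filter fun j : Fin K => (j : ℕ) < m).card = m := by
        rw [Fin.card_filter_val_lt, min_eq_right hm]
      push_cast
      rw [← Finset.sum_filter, ← Finset.sum_filter, Finset.sum_sub_distrib,
        Finset.sum_const, hcard, nsmul_eq_mul, ← Finset.sum_div]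
    simp only [e, e2]
    rw [Real.exp_le_exp]
    have h4 := div_le_div_of_nonneg_right hω.le hH'.le
    have e3 : (m * w / 2 - 2 * H * L) / H = m * (w / (2 * H)) - 2 * L := by
      field_simp
    rw [e3] at h4
    linarith

theorem betaBar_le {H k : ℕ} {L : ℝ} (hL : 0 ≤ L) (η : Fin k → Traj S A H) (s : S) (a : A) :
    betaBar L η s a ≤ 2 * √(Fintype.card S * L / (max (count η s a) 1 : ℕ)) +
      14 / 3 * (Fintype.card S * L / (max (count η s a) 1 : ℕ)) := by
  unfold betaBar beta
  set n : ℕ := max (count η s a) 1 with hn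
  have hn1 : 1 ≤ n := le_max_right _ _
  have hn0 : (0 : ℝ) < n := by exact_mod_cast hn1
  rw [Finset.sum_add_distrib]
  refine add_le_add ?_ (le_of_eq ?_)
  · have h0 : ∀ s', 0 ≤ empModel η s a s' := fun s' => by unfold empModel; positivity
    have hsum : ∑ s', empModel η s a s' ≤ 1 := by
      unfold empModel
      rw [← Finset.sum_div, ← hn, div_le_one hn0, ← Nat.cast_sum, sum_countNext]
      exact_mod_cast le_max_left _ _
    calc _ ≤ ∑ s' : S, √1 * √(4 * empModel η s a s' * L / n) := by
          refine Finset.sum_le_sum fun s' _ => ?_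
          rw [Real.sqrt_one, one_mul]
          refine Real.sqrt_le_sqrt ?_
          gcongr
          nlinarith [h0 s']
      _ ≤ √(∑ _s' : S, 1) * √(∑ s' : S, 4 * empModel η s a s' * L / n) :=
          Real.sum_sqrt_mul_sqrt_le _ (fun _ => zero_le_one)
            (fun s' => by have := h0 s'; positivity)
      _ ≤ √(Fintype.card S) * √(4 * L / n) := by
          have e : ∑ s' : S, 4 * empModel η s a s' * L / n =
              (4 * L / n) * ∑ s', empModel η s a s' := by
            rw [Finset.mul_sum]
            exact Finset.sum_congr rfl fun s' _ => by ring
          rw [e]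
          refine mul_le_mul (by simp) (Real.sqrt_le_sqrt ?_) (Real.sqrt_nonneg _)
            (Real.sqrt_nonneg _)
          exact mul_le_of_le_one_right (by positivity) hsum
      _ = 2 * √(Fintype.card S * L / n) := by
          rw [← Real.sqrt_mul (Nat.cast_nonneg _)]
          have e : (Fintype.card S : ℝ) * (4 * L / n) = 2 ^ 2 * (Fintype.card S * L / n) := by
            ring
          rw [e, Real.sqrt_mul (by positivity), Real.sqrt_sq zero_le_two]
  · rw [Finset.sum_const, Finset.card_univ, nsmul_eq_mul]
    field_simp

/-- The contribution of one state-action pair to the expected sum of the confidence radii. -/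
theorem occupancy_mul_radius_le {w N m h y L α : ℝ} (hw : 0 ≤ w) (hN : 1 ≤ N) (hm : 0 < m)
    (hh : 1 ≤ h) (hL : 1 / 2 ≤ L) (hy : 1 ≤ y) (hα : 0 < α)
    (hwN : m * w / 2 - 2 * h * L ≤ N) :
    w * (2 * √(y * L / N) + 14 / 3 * (y * L / N)) ≤
      2 * α * w + 2 * (y * L) / (α * m) + 70 * (y * h * L ^ 2 / m) := by
  have hN0 : 0 < N := by linarith
  have hL0 : 0 < L := by linarith
  have hyL : 1 / 2 ≤ y * L := by nlinarith
  have hhL : 1 ≤ 2 * (h * L) := by nlinarith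
  have hlin : w * (14 / 3 * (y * L / N)) ≤ 112 / 3 * (y * h * L ^ 2 / m) := by
    have h1 : w / N ≤ 8 * (h * L) / m := by
      rw [div_le_div_iff₀ hN0 hm]
      nlinarith [mul_le_mul_of_nonneg_left hN (by positivity : 0 ≤ h * L)]
    calc _ = 14 / 3 * (y * L) * (w / N) := by ring
      _ ≤ 14 / 3 * (y * L) * (8 * (h * L) / m) := by gcongr
      _ = _ := by ring
  have hroot : w * √(y * L / N) ≤ α * w + y * L / (α * m) + 16 * (y * h * L ^ 2 / m) := by
    have hs0 := Real.sqrt_nonneg (y * L / N)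
    have hsq := Real.sq_sqrt (show 0 ≤ y * L / N by positivity)
    rcases le_total (2 * h * L) N with hc | hc
    · have h1 : √(y * L / N) ≤ α + y * L / N / (4 * α) := by
        generalize √(y * L / N) = z at hsq
        rw [← hsq, ← sub_le_iff_le_add', le_div_iff₀ (by positivity)]
        nlinarith [sq_nonneg (z - 2 * α)]
      have h2 : w / N ≤ 4 / m := by
        rw [div_le_div_iff₀ hN0 hm]
        linarith
      have h3 : 0 ≤ 16 * (y * h * L ^ 2 / m) := by positivity
      calc _ ≤ w * (α + y * L / N / (4 * α)) := mul_le_mul_of_nonneg_left h1 hw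
        _ = α * w + y * L / (4 * α) * (w / N) := by field_simp
        _ ≤ α * w + y * L / (4 * α) * (4 / m) := by gcongr
        _ = α * w + y * L / (α * m) := by field_simp
        _ ≤ _ := by linarith
    · have h1 : w ≤ 8 * (h * L) / m := by
        rw [le_div_iff₀ hm]
        linarith
      have h2 : √(y * L / N) ≤ 2 * (y * L) := by
        rw [Real.sqrt_le_left (by positivity), div_le_iff₀ hN0]
        nlinarith [mul_le_mul_of_nonneg_left hN (by positivity : 0 ≤ (2 * (y * L)) ^ 2)]
      have h3 : 0 ≤ α * w + y * L / (α * m) := by positivity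
      calc _ ≤ 8 * (h * L) / m * (2 * (y * L)) := mul_le_mul h1 h2 hs0 (by positivity)
        _ = 16 * (y * h * L ^ 2 / m) := by ring
        _ ≤ _ := by linarith
  have e : 2 * (y * L) / (α * m) = 2 * (y * L / (α * m)) := by ring
  rw [e]
  have h5 : 0 ≤ y * h * L ^ 2 / m := by positivity
  linarith

/-- Once every pair has been visited often enough, the baseline policy and the true model are
feasible for the optimistic-pessimistic problem. -/
theorem CMDP.baseline_mem_opFeasible [Nonempty A] {H k m : ℕ} (hH : 0 < H) {M : CMDP S A}
    {L : ℝ} (hL : 1 / 2 ≤ L) {π : Policy S A H} {Δ : ℝ} (hΔ : 0 < Δ) (hΔH : Δ ≤ H)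
    (hval : value M.c π M.P M.s₁ + Δ ≤ M.Cbar)
    (hm : 256 * ((Fintype.card S : ℝ) ^ 2 * Fintype.card A * (H : ℝ) ^ 3 / Δ ^ 2) * L ^ 2 ≤ m)
    {η : Fin k → Traj S A H} (hP : M.P ∈ confSet L η)
    (hcount : ∀ s a, m * occupancy M.P π M.s₁ s a / 2 - 2 * H * L ≤ count η s a) :
    (π, M.P) ∈ M.opFeasible L η := by
  refine ⟨hP, ?_⟩
  have : Nonempty S := ⟨M.s₁⟩
  have hy : (1 : ℝ) ≤ Fintype.card S := by exact_mod_cast Fintype.card_pos (α := S)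
  have hx : (1 : ℝ) ≤ Fintype.card A := by exact_mod_cast Fintype.card_pos (α := A)
  have hh : (1 : ℝ) ≤ H := by exact_mod_cast hH
  have hL0 : 0 < L := by linarith
  have hm0 : (0 : ℝ) < m := lt_of_lt_of_le (by positivity) hm
  have hα : 0 < Δ / (8 * (H : ℝ) ^ 2) := by positivity
  have hsum : ∑ s, ∑ a, occupancy M.P π M.s₁ s a * betaBar L η s a ≤
      2 * (Δ / (8 * (H : ℝ) ^ 2)) * H + Fintype.card S * (Fintype.card A *
        (2 * (Fintype.card S * L) / (Δ / (8 * (H : ℝ) ^ 2) * m) +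
          70 * (Fintype.card S * H * L ^ 2 / m))) := by
    calc _ ≤ ∑ s, ∑ a, (2 * (Δ / (8 * (H : ℝ) ^ 2)) * occupancy M.P π M.s₁ s a +
          (2 * (Fintype.card S * L) / (Δ / (8 * (H : ℝ) ^ 2) * m) +
          70 * (Fintype.card S * H * L ^ 2 / m))) := by
          refine Finset.sum_le_sum fun s _ => Finset.sum_le_sum fun a _ => ?_
          have h0 := occupancy_nonneg M.P π M.s₁ s a
          rw [← add_assoc]
          refine (mul_le_mul_of_nonneg_left (betaBar_le hL0.le η s a) h0).trans
            (occupancy_mul_radius_le h0 ?_ hm0 hh hL hy hα ((hcount s a).trans ?_))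
          · exact_mod_cast le_max_right _ _
          · exact_mod_cast le_max_left _ _
      _ = _ := by
          simp only [Finset.sum_add_distrib, ← Finset.mul_sum, sum_occupancy, Finset.sum_const,
            Finset.card_univ, nsmul_eq_mul]
          ring
  have e : value (M.pessCost L η) π M.P M.s₁ = value M.c π M.P M.s₁ +
      H * ∑ s, ∑ a, occupancy M.P π M.s₁ s a * betaBar L η s a := by
    rw [value_eq_sum_occupancy, value_eq_sum_occupancy]
    simp only [CMDP.pessCost, mul_add, Finset.sum_add_distrib, Finset.mul_sum]
    congr 1
    refine Finset.sum_congr rfl fun s _ => Finset.sum_congr rfl fun a _ => ?_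
    ring
  simp only [e]
  have hHsum := mul_le_mul_of_nonneg_left hsum (by linarith : (0 : ℝ) ≤ H)
  refine le_trans (add_le_add le_rfl (hHsum.trans ?_)) hval
  generalize (Fintype.card S : ℝ) = y at *
  generalize (Fintype.card A : ℝ) = x at *
  generalize (H : ℝ) = h at *
  generalize (m : ℝ) = μ at *
  have hR : y ^ 2 * x * h ^ 3 * L ^ 2 / μ ≤ Δ ^ 2 / 256 := by
    rw [div_le_div_iff₀ hm0 (by norm_num)]
    have e1 : 256 * (y ^ 2 * x * h ^ 3 / Δ ^ 2) * L ^ 2 =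
        (256 * (y ^ 2 * x * h ^ 3 * L ^ 2)) / Δ ^ 2 := by ring
    rw [e1, div_le_iff₀ (by positivity)] at hm
    linarith
  have hR0 : 0 ≤ y ^ 2 * x * h ^ 3 * L ^ 2 / μ := by positivity
  have e2 : h * (2 * (Δ / (8 * h ^ 2)) * h + y * (x * (2 * (y * L) / (Δ / (8 * h ^ 2) * μ) +
      70 * (y * h * L ^ 2 / μ)))) = Δ / 4 + 16 * (y ^ 2 * x * h ^ 3 * L / μ) / Δ +
        70 * (y ^ 2 * x * h ^ 3 * L ^ 2 / μ) / h := by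
    field_simp
    ring
  rw [e2]
  have h1 : 16 * (y ^ 2 * x * h ^ 3 * L / μ) / Δ ≤ 32 / 256 * Δ := by
    rw [div_le_iff₀ hΔ]
    have : y ^ 2 * x * h ^ 3 * L / μ ≤ 2 * (y ^ 2 * x * h ^ 3 * L ^ 2 / μ) := by
      have e3 : 2 * (y ^ 2 * x * h ^ 3 * L ^ 2 / μ) =
          (y ^ 2 * x * h ^ 3 * L / μ) * (2 * L) := by ring
      rw [e3]
      exact le_mul_of_one_le_right (by positivity) (by linarith)
    nlinarith
  have h2 : 70 * (y ^ 2 * x * h ^ 3 * L ^ 2 / μ) / h ≤ 70 / 256 * Δ := by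
    rw [div_le_iff₀ (by linarith)]
    nlinarith
  linarith

theorem runProb_univ {H K : ℕ} (P : Model S A) (s₁ : S) (ρ : Rule S A H) :
    runProb (K := K) P s₁ ρ Set.univ = 1 := by
  rw [runProb_compl, runProb_eq]
  simp

/-- With high probability every pair is visited often in the baseline episodes. -/
theorem runProb_exists_visits_lt_le [Nonempty S] [Nonempty A] {H K m : ℕ} (hH : 0 < H)
    (hK : 0 < K) (hm : m ≤ K) {δ : ℝ} (hδ : 0 < δ) (hδ1 : δ < 1) (P : Model S A) (s₁ : S)
    {ρ : Rule S A H} {π : Policy S A H} (hρ : ∀ k < m, ∀ η, ρ k η = π) :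
    runProb P s₁ ρ {ω : Fin K → Traj S A H | ∃ s a,
      ((∑ j : Fin K, if (j : ℕ) < m then visits s a (ω j) else 0 : ℕ) : ℝ) <
        m * occupancy P π s₁ s a / 2 - 2 * H * logTerm S A H K δ} ≤ δ := by
  have hunion := runProb_iUnion_le P s₁ ρ
    (fun i : S × A => {ω : Fin K → Traj S A H |
      ((∑ j : Fin K, if (j : ℕ) < m then visits i.1 i.2 (ω j) else 0 : ℕ) : ℝ) <
        m * occupancy P π s₁ i.1 i.2 / 2 - 2 * H * logTerm S A H K δ})
    (fun i => runProb_visits_lt_le hH hm P s₁ hρ i.1 i.2 (logTerm S A H K δ))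
  refine le_trans (runProb_mono _ _ _ ?_) (hunion.trans ?_)
  · rintro ω ⟨s, a, hω⟩
    exact Set.mem_iUnion.2 ⟨(s, a), hω⟩
  · rw [exp_neg_two_logTerm hH hK hδ, Fintype.card_prod]
    have h1 : (1 : ℝ) ≤ Fintype.card S := by exact_mod_cast Fintype.card_pos (α := S)
    have h2 : (1 : ℝ) ≤ Fintype.card A := by exact_mod_cast Fintype.card_pos (α := A)
    have h3 : (1 : ℝ) ≤ H := by exact_mod_cast hH
    have h4 : (1 : ℝ) ≤ K := by exact_mod_cast hK
    push_cast
    generalize (Fintype.card S : ℝ) = x at *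
    generalize (Fintype.card A : ℝ) = y at *
    generalize (H : ℝ) = h at *
    generalize (K : ℝ) = z at *
    have hxy : 1 ≤ x * y := one_le_mul_of_one_le_of_one_le h1 h2
    have hhz : 1 ≤ h * z := one_le_mul_of_one_le_of_one_le h3 h4
    have e : x * y * (δ / (2 * x * y * h * z)) ^ 2 = δ ^ 2 / (4 * (x * y) * (h * z) ^ 2) := by
      field_simp
      norm_num
    rw [e, div_le_iff₀ (by positivity)]
    have h5 : 1 ≤ 4 * (x * y) * (h * z) ^ 2 := by
      have : 1 ≤ (h * z) ^ 2 := one_le_pow₀ hhz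
      nlinarith
    nlinarith

theorem IsOPSRL.safe_of_mem_confSet {H K : ℕ} {M : CMDP S A} {δ Cb : ℝ} {πb : Policy S A H}
    {Ko : ℕ} {ρ : Rule S A H} (hρ : IsOPSRL M K δ Cb πb Ko ρ) (hb : M.Safe πb) {k : ℕ}
    (hk : k < K) {η : Fin k → Traj S A H} (hP : M.P ∈ confSet (logTerm S A H K δ) η)
    (hf : k + 1 ≤ Ko ∨ (M.opFeasible (logTerm S A H K δ) η).Nonempty) : M.Safe (ρ k η) := by
  rcases le_or_gt (k + 1) Ko with h | h
  · rw [hρ.baseline k hk h η]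
    exact hb
  · obtain ⟨P', hP'⟩ := hρ.solve k hk h η (hf.resolve_left (by omega))
    exact CMDP.safe_of_mem_confSet (x := (ρ k η, P')) hP hP'.1

end OPSRL

end

theorem proposition2 :
    ∃ (κ : ℝ) (p : ℕ), 0 < κ ∧
      ∀ (S A : Type*) [Fintype S] [DecidableEq S] [Fintype A] [DecidableEq A]
        (H K : ℕ) (M : OPSRL.CMDP S A) (δ : ℝ) (_ : 0 < δ) (_ : δ < 1)
        (πb : OPSRL.Policy S A H) (Cb : ℝ)
        (_ : OPSRL.value M.c πb M.P M.s₁ = Cb) (_ : Cb < M.Cbar)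
        (Ko : ℕ) (ρ : OPSRL.Rule S A H) (_ : OPSRL.IsOPSRL M K δ Cb πb Ko ρ),
        1 - 3 * δ < OPSRL.runProb (K := K) M.P M.s₁ ρ
            {ω | ∀ k : Fin K,
              ((k : ℕ) + 1 ≤ Ko ∨
                (M.opFeasible (OPSRL.logTerm S A H K δ) (OPSRL.past ω k)).Nonempty) →
              M.Safe (ρ k (OPSRL.past ω k))} ∧
        (κ * ((Fintype.card S : ℝ) ^ 2 * Fintype.card A * (H : ℝ) ^ 3 / (M.Cbar - Cb) ^ 2) *
              OPSRL.logTerm S A H K δ ^ p ≤ Ko →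
          1 - 3 * δ < OPSRL.runProb (K := K) M.P M.s₁ ρ
            {ω | ∀ k : Fin K, M.Safe (ρ k (OPSRL.past ω k))}) := by
  refine ⟨256, 2, by norm_num, ?_⟩
  intro S A _ _ _ _ H K M δ hδ hδ1 πb Cb hval hCb Ko ρ hρ
  have hb : M.Safe πb := hval.trans_le hCb.le
  have hsure : (∀ (ω : Fin K → OPSRL.Traj S A H) (k : Fin K), M.Safe (ρ k (OPSRL.past ω k))) →
      1 - 3 * δ < OPSRL.runProb (K := K) M.P M.s₁ ρ
        {ω | ∀ k : Fin K, M.Safe (ρ k (OPSRL.past ω k))} := by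
    intro h
    refine lt_of_lt_of_le ?_ (OPSRL.runProb_mono (E := Set.univ) _ _ _ fun ω _ => h ω)
    rw [OPSRL.runProb_univ]
    linarith
  by_cases hbig : (H : ℝ) ≤ M.Cbar
  · have hall : ∀ π : OPSRL.Policy S A H, M.Safe π := fun π =>
      (OPSRL.value_mem_Icc M.c_mem π M.P M.s₁).2.trans hbig
    exact ⟨(hsure fun ω k => hall _).trans_le
      (OPSRL.runProb_mono _ _ _ fun ω hω k _ => hω k), fun _ => hsure fun ω k => hall _⟩
  rw [not_le] at hbig
  have hCb0 : 0 ≤ Cb := hval ▸ (OPSRL.value_mem_Icc M.c_mem πb M.P M.s₁).1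
  have hH : 0 < H := by
    have : (0 : ℝ) < H := by linarith
    exact_mod_cast this
  rcases Nat.eq_zero_or_pos K with rfl | hK
  · have h := hsure fun ω k => k.elim0
    exact ⟨h.trans_le (OPSRL.runProb_mono _ _ _ fun ω hω k _ => hω k), fun _ => h⟩
  have : Nonempty S := ⟨M.s₁⟩
  have : Nonempty A := by
    by_contra hA
    rw [not_nonempty_iff] at hA
    have := (πb.2 ⟨0, hH⟩ M.s₁).2
    simp at this
  have hconf := OPSRL.runProb_notMem_confSet_le hH hK hδ hδ1 M.P M.s₁ ρ
  constructor
  · rw [OPSRL.runProb_compl]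
    refine lt_of_lt_of_le ?_ (sub_le_sub_left ((OPSRL.runProb_mono _ _ _
      (Set.compl_subset_compl.2 ?_)).trans hconf) 1)
    · linarith
    · exact fun ω hω k hk => hρ.safe_of_mem_confSet hb k.isLt (hω k) hk
  intro hKo
  rcases le_or_gt K Ko with hle | hlt
  · refine hsure fun ω k => ?_
    rw [hρ.baseline k k.isLt (by omega)]
    exact hb
  have hbase : ∀ k < Ko, ∀ η, ρ k η = πb := fun k hk η =>
    hρ.baseline k (by omega) (by omega) η
  have hcount := OPSRL.runProb_exists_visits_lt_le hH hK hlt.le hδ hδ1 M.P M.s₁ hbase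
  rw [OPSRL.runProb_compl]
  refine lt_of_lt_of_le ?_ (sub_le_sub_left ((OPSRL.runProb_mono _ _ _ ?_).trans
    ((OPSRL.runProb_union_le _ _ _ _ _).trans (add_le_add hconf hcount))) 1)
  · linarith
  intro ω hω
  by_contra hgood
  rw [Set.mem_union, not_or, Set.mem_compl_iff, not_not] at hgood
  obtain ⟨hP, hN⟩ := hgood
  refine hω fun k => hρ.safe_of_mem_confSet hb k.isLt (hP k) ?_
  rcases le_or_gt ((k : ℕ) + 1) Ko with h | h
  · exact Or.inl h
  refine Or.inr ⟨_, OPSRL.CMDP.baseline_mem_opFeasible hH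
    (OPSRL.one_half_le_logTerm hH hK hδ hδ1) (sub_pos.2 hCb) (by linarith) (by linarith)
    hKo (hP k) fun s a => ?_⟩
  have h1 : ¬ _ < _ := fun h => hN ⟨s, a, h⟩
  refine (not_lt.1 h1).trans ?_
  rw [OPSRL.count_past]
  refine Nat.cast_le.2 (Finset.sum_le_sum fun j _ => ?_)
  split_ifs with h2 h3
  · exact le_rfl
  · omega
  · exact Nat.zero_le _
  · exact le_rfl
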